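/- Let $E$ be a complex Banach space and let $C\in L(E)$ be injective. Let $\mathcal D=C_c^\infty(\mathbb R)$ be the space of complex test functions, $\mathcal D_0$ the set of $\varphi\in\mathcal D$ with $\operatorname{supp}\varphi\subseteq[0,\infty)$, $\mathcal D_0'(L(E))$ the space of continuous linear maps $\mathcal D\to L(E)$ with support in $[0,\infty)$, and $(\varphi*_0\psi)(t)=\int_0^t\varphi(t-s)\psi(s)\,ds$ for $t\in\mathbb R$. A function $f:[0,\infty)\to E$ is almost periodic if for every $\varepsilon>0$ there is $l>0$ such that every interval of length $l$ in $[0,\infty)$ contains some $\tau$ with $\|f(t+\tau)-f(t)\|\le\varepsilon$ for all $t\ge0$. Operators are identified with their graphs, and eigenvectors are nonzero. *$C$-distribution semigroups.* A map $\mathcal G\in\mathcal D_0'(L(E))$ with $C\mathcal G(\varphi)=\mathcal G(\varphi)C$ for all $\varphi\in\mathcal D$ is a $C$-distribution semigroup if $\mathcal G(\varphi*_0\psi)C=\mathcal G(\varphi)\mathcal G(\psi)$ for all $\varphi,\psi\in\mathcal D$ and if $\mathcal G(\varphi)x=0$ for all $\varphi\in\mathcal D_0$ implies $x=0$. Its generator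 is $A=\{(x,y):\mathcal G(-\varphi')x=\mathcal G(\varphi)y\ \text{for all}\ \varphi\in\mathcal D_0\}$, and for $t\ge0$ one puts $G(\delta_t)=\{(x,y):\mathcal G(\varphi(\cdot-t))x=\mathcal G(\varphi)y\ \text{for all}\ \varphi\in\mathcal D_0\}$. Let $Z(A)$ be the set of all $x\in E$ for which there is a continuous $u:[0,\infty)\to E$ with $\int_0^tu(s)\,ds\in D(A)$ and $A\int_0^tu(s)\,ds=u(t)-x$ for all $t\ge0$; every $x\in Z(A)$ lies in $D(G(\delta_t))$ for all $t\ge0$. For a linear subspace $\tilde E\subseteq Z(A)$, $\mathcal G$ is $\tilde E$-almost periodic if $t\mapsto G(\delta_t)x$, $t\ge0$, is almost periodic for each $x\in\tilde E$. *$C$-distribution cosine functions.* Fix $\zeta\in\mathcal D$ with $\operatorname{supp}\zeta\subseteq[-2,-1]$ and $\int\zeta=1$, put $I(\varphi)(x)=\int_{-\infty}^x\bigl[\varphi(t)-\zeta(t)\int\varphi\bigr]dt$, and for $\mathbf G\in\mathcal D_0'(L(E))$ put $\mathbf G^{-1}(\varphi)=-\mathbf G(I(\varphi))$. If $\mathbf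 G(\varphi)C=C\mathbf G(\varphi)$ for all $\varphi\in\mathcal D$, then $\mathbf G$ is a $C$-distribution cosine function if $\mathbf G^{-1}(\varphi*_0\psi)C=\mathbf G^{-1}(\varphi)\mathbf G(\psi)+\mathbf G(\varphi)\mathbf G^{-1}(\psi)$ for all $\varphi,\psi\in\mathcal D$ and if $\mathbf G(\varphi)x+\mathbf G^{-1}(\varphi)y=0$ for all $\varphi\in\mathcal D_0$ implies $x=y=0$. Its generator is $A=\{(x,y):\mathbf G^{-1}(\varphi'')x=\mathbf G^{-1}(\varphi)y\ \text{for all}\ \varphi\in\mathcal D_0\}$. Let $Z_2(A)$ be the set of all $x\in E$ for which there is a continuous $u:[0,\infty)\to E$ with $\int_0^t(t-s)u(s)\,ds\in D(A)$ and $A\int_0^t(t-s)u(s)\,ds=u(t)-x$ for all $t\ge0$. With the operator matrix $\mathcal G=\begin{pmatrix}\mathbf G&\mathbf G^{-1}\\ \mathbf G'-\delta\otimes C&\mathbf G\end{pmatrix}$ on $E\times E$ (where $\mathbf G'(\varphi)=-\mathbf G(\varphi')$ and $(\delta\otimes C)(\varphi)=\varphi(0)C$), let $\mathcal G(\delta_t)$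 be the operator on $E\times E$ that is assigned to this matrix by the formula for $G(\delta_t)$ above, and let $G(\delta_t)x$ be the second component of $\mathcal G(\delta_t)(0,x)$, for $x\in Z_2(A)$ and $t\ge0$. For a linear subspace $\tilde E\subseteq Z_2(A)$, $\mathbf G$ is $\tilde E$-almost periodic if $t\mapsto G(\delta_t)x$, $t\ge0$, is almost periodic for each $x\in\tilde E$. **Theorem.** (i) Let $\mathcal G$ be a $C$-distribution semigroup generated by $A$ that is $\tilde E$-almost periodic for some linear subspace $\tilde E$ of $Z(A)$. Then for all $r\in\mathbb R$ and $x\in\tilde E$ the limit $$P_rx:=\lim_{t\to\infty}\frac1t\int_0^te^{-irs}G(\delta_s)x\,ds$$ exists, $P_rx\in D(A)$ and $AP_rx=irP_rx$. Furthermore, if $\tilde E$ is dense in $E$, then the set of all eigenvectors of $A$ that correspond to eigenvalues of the form $ir$, $r\in\mathbb R$ (including $0$), is total in $E$, i.e. its linear span is dense in $E$. (ii) Let $\mathbf G$ be a $C$-distribution cosine function generated by $A$ that is $\tilde E$-almost periodic for some linear subspace $\tilde E$ of $Z_2(A)$. Then for all $r\in\mathbb R$ and $x\in\tilde E$ the limit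 $P_rx$, defined by the same formula, exists, $P_rx\in D(A)$ and $AP_rx=-r^2P_rx$. Furthermore, if $\tilde E$ is dense in $E$, then the set of all eigenvectors of $A$ that correspond to non-positive real eigenvalues is total in $E$. -/

import Mathlib

open Set Filter Topology TopologicalSpace MeasureTheory
open scoped Distributions

namespace CDist

noncomputable section

/-! ### Test functions on the real line -/

/-- The space of complex test functions `C_c^∞(ℝ)` with its usual inductive limit topology. -/
abbrev TestFn : Type := 𝓓((⊤ : Opens ℝ), ℂ)

/-- The test functions whose support is contained in `[0, ∞)`. -/
def testFnNonneg : Set TestFn := {φ | tsupport φ ⊆ Ici 0}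

/-- The derivative `φ'` of a test function. -/
def tderiv (φ : TestFn) : TestFn := TestFunction.lineDerivCLM ℂ (1 : ℝ) φ

theorem tderiv_apply (φ : TestFn) (x : ℝ) : tderiv φ x = deriv φ x := by
  rw [tderiv, TestFunction.lineDerivCLM_apply_of_le (by simp)]
  rw [lineDeriv, show (fun t : ℝ => φ (x + t • (1 : ℝ))) = fun t => φ (x + t) by simp,
    deriv_comp_const_add, add_zero]

theorem exists_bound_support (φ : TestFn) : ∃ R : ℝ, 0 < R ∧ ∀ x, R < |x| → φ x = 0 := by
  obtain ⟨R, hR⟩ := φ.hasCompactSupport.isCompact.isBounded.subset_closedBall (0 : ℝ)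
  refine ⟨max R 1, lt_max_of_lt_right one_pos, fun x hx => ?_⟩
  by_contra h
  have := hR (subset_tsupport _ h)
  rw [mem_closedBall_zero_iff, Real.norm_eq_abs] at this
  exact absurd (le_max_left R 1) (not_le.2 (hx.trans_le this))

/-- The translate `δ_t * φ`, i.e. `s ↦ φ (s - t)`. -/
def translate (t : ℝ) (φ : TestFn) : TestFn where
  toFun s := φ (s - t)
  contDiff' := φ.contDiff.comp (contDiff_id.sub contDiff_const)
  hasCompactSupport' := φ.hasCompactSupport.comp_homeomorph (Homeomorph.subRight t)
  tsupport_subset' := fun _ _ => trivial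

theorem contDiff_parametric_aux (n : ℕ) : ∀ g : ℝ × ℝ → ℂ, ContDiff ℝ (⊤ : ℕ∞) g →
    ContDiff ℝ n (fun t => ∫ u in (0 : ℝ)..1, g (t, u)) := by
  induction n with
  | zero =>
    intro g hg
    refine contDiff_zero.2 ?_
    exact intervalIntegral.continuous_parametric_intervalIntegral_of_continuous'
      (f := fun t u => g (t, u)) (by simpa [Function.uncurry_def] using hg.continuous) 0 1
  | succ n ih =>
    intro g hg
    set g' : ℝ × ℝ → ℂ := fun p => fderiv ℝ g p (1, 0) with hg'
    have hg's : ContDiff ℝ (⊤ : ℕ∞) g' :=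
      (hg.fderiv_right (m := (⊤ : ℕ∞)) (by simp)).clm_apply contDiff_const
    have hd : ∀ t u, HasDerivAt (fun t => g (t, u)) (g' (t, u)) t := by
      intro t u
      have h1 : HasFDerivAt g (fderiv ℝ g (t, u)) (t, u) :=
        (hg.differentiable (by simp) _).hasFDerivAt
      have h2 : HasDerivAt (fun t : ℝ => (t, u)) ((1 : ℝ), (0 : ℝ)) t :=
        (hasDerivAt_id t).prodMk (hasDerivAt_const t u)
      exact h1.comp_hasDerivAt t h2
    have key : ∀ t, HasDerivAt (fun t => ∫ u in (0 : ℝ)..1, g (t, u))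
        (∫ u in (0 : ℝ)..1, g' (t, u)) t := by
      intro t
      obtain ⟨M, hM⟩ := ((isCompact_closedBall t 1).prod
        (isCompact_Icc (a := (0 : ℝ)) (b := 1))).exists_bound_of_continuousOn
        hg's.continuous.continuousOn
      have hc : ∀ (h : ℝ × ℝ → ℂ), Continuous h → ∀ x : ℝ, Continuous (fun u => h (x, u)) :=
        fun h hh x => hh.comp (by fun_prop)
      refine (intervalIntegral.hasDerivAt_integral_of_dominated_loc_of_deriv_le
        (F := fun t u => g (t, u)) (F' := fun t u => g' (t, u)) (bound := fun _ => M)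
        (Metric.closedBall_mem_nhds t one_pos)
        (Eventually.of_forall fun x => (hc g hg.continuous x).aestronglyMeasurable)
        ((hc g hg.continuous t).intervalIntegrable _ _)
        ((hc g' hg's.continuous t).aestronglyMeasurable)
        (Eventually.of_forall fun u hu x hx => hM (x, u) ⟨hx, ?_⟩)
        (by simp)
        (Eventually.of_forall fun u _ x _ => hd x u)).2
      rw [uIoc_of_le zero_le_one] at hu
      exact Ioc_subset_Icc_self hu
    rw [Nat.cast_succ, contDiff_succ_iff_deriv]
    refine ⟨fun t => (key t).differentiableAt, by simp, ?_⟩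
    rw [show deriv (fun t => ∫ u in (0 : ℝ)..1, g (t, u)) =
      fun t => ∫ u in (0 : ℝ)..1, g' (t, u) from funext fun t => (key t).deriv]
    exact ih g' hg's

/-- The truncated convolution `(φ *₀ ψ)(t) = ∫₀ᵗ φ(t - s) ψ(s) ds`, `t ∈ ℝ`. -/
def conv₀ (φ ψ : TestFn) : TestFn where
  toFun t := ∫ s in (0 : ℝ)..t, φ (t - s) * ψ s
  contDiff' := by
    have h : (fun t : ℝ => ∫ s in (0 : ℝ)..t, φ (t - s) * ψ s) =
        fun t : ℝ => t • ∫ u in (0 : ℝ)..1, φ (t - t * u) * ψ (t * u) := by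
      funext t
      have := intervalIntegral.smul_integral_comp_mul_left (a := 0) (b := 1)
        (fun s => φ (t - s) * ψ s) t
      simpa using this.symm
    rw [h]
    refine contDiff_id.smul (contDiff_infty.2 fun n => contDiff_parametric_aux n
      (fun p => φ (p.1 - p.1 * p.2) * ψ (p.1 * p.2)) ?_)
    exact (φ.contDiff.comp (by fun_prop)).mul (ψ.contDiff.comp (by fun_prop))
  hasCompactSupport' := by
    obtain ⟨R, _, hR⟩ := exists_bound_support φ
    obtain ⟨S, _, hS⟩ := exists_bound_support ψ
    refine HasCompactSupport.intro (isCompact_closedBall (0 : ℝ) (R + S)) fun t ht => ?_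
    rw [mem_closedBall_zero_iff, Real.norm_eq_abs, not_le] at ht
    have : ∀ s, φ (t - s) * ψ s = 0 := by
      intro s
      by_cases hs : S < |s|
      · rw [hS s hs, mul_zero]
      · rw [hR (t - s), zero_mul]
        have := abs_add_le (t - s) s
        rw [sub_add_cancel] at this
        linarith
    simp [this]
  tsupport_subset' := fun _ _ => trivial

/-- A test function `ζ` supported in `[-2, -1]` with `∫ ζ = 1`. It normalizes the primitive of a
distribution. -/
structure Normalizer where
  /-- the underlying test function -/
  ζ : TestFn
  tsupport_subset : tsupport ζ ⊆ Icc (-2) (-1)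
  integral_eq_one : ∫ t, ζ t = 1

theorem Normalizer.nonempty : Nonempty Normalizer := by
  let b : ContDiffBump (-3 / 2 : ℝ) := ⟨1 / 4, 1 / 2, by norm_num, by norm_num⟩
  have hs : tsupport (fun x => (b.normed volume x : ℂ)) ⊆ Metric.closedBall (-3 / 2) (1 / 2) := by
    refine (tsupport_comp_subset (g := ((↑) : ℝ → ℂ)) rfl _).trans ?_
    rw [b.tsupport_normed_eq]
  refine ⟨⟨⟨fun x => (b.normed volume x : ℂ), ?_, ?_, fun _ _ => trivial⟩, ?_, ?_⟩⟩
  · exact Complex.ofRealCLM.contDiff.comp b.contDiff_normed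
  · exact (b.hasCompactSupport_normed).comp_left (g := ((↑) : ℝ → ℂ)) rfl
  · refine hs.trans ?_
    rw [Real.closedBall_eq_Icc]
    exact Icc_subset_Icc (by norm_num) (by norm_num)
  · show ∫ t, (b.normed volume t : ℂ) = 1
    rw [integral_complex_ofReal, b.integral_normed]
    simp

/-- `I(φ)(x) = ∫_{-∞}^x (φ(t) - ζ(t) ∫ φ) dt`. -/
def antideriv (N : Normalizer) (φ : TestFn) : TestFn where
  toFun x := ∫ t in Iic x, (φ t - N.ζ t * ∫ u, φ u)
  contDiff' := by
    set g : ℝ → ℂ := fun t => φ t - N.ζ t * ∫ u, φ u with hg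
    have hgs : ContDiff ℝ (⊤ : ℕ∞) g := φ.contDiff.sub (N.ζ.contDiff.mul contDiff_const)
    have hgi : Integrable g := by
      refine (φ.continuous.integrable_of_hasCompactSupport φ.hasCompactSupport).sub
        ((N.ζ.continuous.integrable_of_hasCompactSupport N.ζ.hasCompactSupport).mul_const _)
    have h : (fun x => ∫ t in Iic x, g t) =
        fun x => (∫ t in Iic (0 : ℝ), g t) + ∫ t in (0 : ℝ)..x, g t := by
      funext x
      rw [← intervalIntegral.integral_Iic_sub_Iic hgi.integrableOn hgi.integrableOn]
      ring
    have hd : ∀ x, HasDerivAt (fun x => ∫ t in Iic x, g t) (g x) x := by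
      intro x
      rw [h]
      exact (intervalIntegral.integral_hasDerivAt_right (hgs.continuous.intervalIntegrable _ _)
        (hgs.continuous.stronglyMeasurableAtFilter _ _) hgs.continuous.continuousAt).const_add _
    refine contDiff_infty_iff_deriv.2 ⟨fun x => (hd x).differentiableAt, ?_⟩
    rw [show deriv (fun x => ∫ t in Iic x, g t) = g from funext fun x => (hd x).deriv]
    exact hgs
  hasCompactSupport' := by
    obtain ⟨R, _, hR⟩ := exists_bound_support φ
    obtain ⟨S, _, hS⟩ := exists_bound_support N.ζ
    have hφi := φ.continuous.integrable_of_hasCompactSupport (μ := volume) φ.hasCompactSupport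
    have hζi := N.ζ.continuous.integrable_of_hasCompactSupport (μ := volume)
      N.ζ.hasCompactSupport
    have hz : ∀ t, R + S < |t| → φ t - N.ζ t * ∫ u, φ u = 0 := fun t ht => by
      rw [hR t (by linarith), hS t (by linarith)]; simp
    refine HasCompactSupport.intro (isCompact_closedBall (0 : ℝ) (R + S)) fun x hx => ?_
    rw [mem_closedBall_zero_iff, Real.norm_eq_abs, not_le, lt_abs] at hx
    rcases hx with hx | hx
    · rw [setIntegral_eq_integral_of_forall_compl_eq_zero fun t ht => ?_]
      · rw [integral_sub hφi (hζi.mul_const _), integral_mul_const, N.integral_eq_one]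
        simp
      · rw [mem_Iic, not_le] at ht
        exact hz t (lt_abs.2 (Or.inl (hx.trans ht)))
    · refine setIntegral_eq_zero_of_forall_eq_zero fun t ht => hz t (lt_abs.2 (Or.inr ?_))
      rw [mem_Iic] at ht
      linarith
  tsupport_subset' := fun _ _ => trivial

/-! ### Operators and solution spaces -/

section Operators

variable {X : Type*} [NormedAddCommGroup X] [NormedSpace ℂ X]

/-- The solution space `Z(A)`: the initial values `x` of the mild solutions on `[0, ∞)` of
`u' = A u`, `u(0) = x`. -/
def solutionSpace (A : X →ₗ.[ℂ] X) : Set X :=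
  {x | ∃ u : ℝ → X, ContinuousOn u (Ici 0) ∧
    ∀ t : ℝ, 0 ≤ t → ((∫ s in (0 : ℝ)..t, u s), u t - x) ∈ A.graph}

/-- The solution space `Z₂(A)`: the initial values `x` of the mild solutions on `[0, ∞)` of
`u'' = A u`, `u(0) = x`, `u'(0) = 0`. -/
def solutionSpace₂ (A : X →ₗ.[ℂ] X) : Set X :=
  {x | ∃ u : ℝ → X, ContinuousOn u (Ici 0) ∧
    ∀ t : ℝ, 0 ≤ t → ((∫ s in (0 : ℝ)..t, (t - s) • u s), u t - x) ∈ A.graph}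

/-- The eigenvectors of `A` for the eigenvalues belonging to `Λ`. -/
def eigenvectors (A : X →ₗ.[ℂ] X) (Λ : Set ℂ) : Set X :=
  {x | x ≠ 0 ∧ ∃ μ ∈ Λ, (x, μ • x) ∈ A.graph}

/-- Almost periodicity on `[0, ∞)`: for every `ε > 0` the set of `ε`-periods is relatively
dense in `[0, ∞)`. -/
def AlmostPeriodic (f : ℝ → X) : Prop :=
  ∀ ε : ℝ, 0 < ε → ∃ l : ℝ, 0 < l ∧ ∀ a : ℝ, 0 ≤ a →
    ∃ τ ∈ Icc a (a + l), ∀ t : ℝ, 0 ≤ t → ‖f (t + τ) - f t‖ ≤ ε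

/-- `p = lim_{t → ∞} (1/t) ∫₀ᵗ e^{-irs} f(s) ds`. -/
def HasBohrMean (f : ℝ → X) (r : ℝ) (p : X) : Prop :=
  Tendsto (fun t : ℝ => t⁻¹ • ∫ s in (0 : ℝ)..t, Complex.exp (-(Complex.I * r * s)) • f s)
    atTop (𝓝 p)

/-! ### `C`-distribution semigroups -/

/-- Operator-valued distributions on `ℝ`: continuous linear maps from the test functions to the
bounded operators on `X`. -/
abbrev OpDist (X : Type*) [NormedAddCommGroup X] [NormedSpace ℂ X] : Type _ :=
  TestFn →L[ℂ] (X →L[ℂ] X)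

/-- `𝒢` is a `C`-distribution semigroup. -/
structure IsCDS (C : X →L[ℂ] X) (𝒢 : OpDist X) : Prop where
  /-- `supp 𝒢 ⊆ [0, ∞)` -/
  support : Distribution.IsVanishingOn 𝒢 (Ici (0 : ℝ))ᶜ
  comm : ∀ φ, C ∘L 𝒢 φ = 𝒢 φ ∘L C
  conv : ∀ φ ψ, 𝒢 (conv₀ φ ψ) ∘L C = 𝒢 φ ∘L 𝒢 ψ
  nondegenerate : ∀ x, (∀ φ ∈ testFnNonneg, 𝒢 φ x = 0) → x = 0

/-- `A` is the generator `G(-δ')` of `𝒢`: its graph consists of the `(x, y)` such that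
`𝒢(-φ') x = 𝒢(φ) y` for all test functions `φ` supported in `[0, ∞)`. -/
def IsGeneratorCDS (𝒢 : OpDist X) (A : X →ₗ.[ℂ] X) : Prop :=
  ∀ x y, (x, y) ∈ A.graph ↔ ∀ φ ∈ testFnNonneg, 𝒢 (-tderiv φ) x = 𝒢 φ y

/-- The graph of the operator `G(δ_t)`: the `(x, y)` such that `𝒢(δ_t * φ) x = 𝒢(φ) y` for all
test functions `φ` supported in `[0, ∞)`. -/
def deltaGraph (𝒢 : TestFn → X →L[ℂ] X) (t : ℝ) : Set (X × X) :=
  {p | ∀ φ ∈ testFnNonneg, 𝒢 (translate t φ) p.1 = 𝒢 φ p.2}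

open Classical in
/-- The value `G(δ_t) x` (and `0` if `x` is not in the domain of `G(δ_t)`). -/
def deltaApply (𝒢 : TestFn → X →L[ℂ] X) (t : ℝ) (x : X) : X :=
  if h : ∃ y, (x, y) ∈ deltaGraph 𝒢 t then h.choose else 0

/-- If `𝒢` is non-degenerate, then `G(δ_t)` is single-valued, so that `deltaApply` computes it. -/
theorem deltaApply_eq {𝒢 : TestFn → X →L[ℂ] X}
    (h𝒢 : ∀ x, (∀ φ ∈ testFnNonneg, 𝒢 φ x = 0) → x = 0) {t : ℝ} {x y : X}
    (h : (x, y) ∈ deltaGraph 𝒢 t) : deltaApply 𝒢 t x = y := by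
  have hex : ∃ y, (x, y) ∈ deltaGraph 𝒢 t := ⟨y, h⟩
  rw [deltaApply, dif_pos hex, ← sub_eq_zero]
  refine h𝒢 _ fun φ hφ => ?_
  rw [map_sub, ← hex.choose_spec φ hφ, ← h φ hφ, sub_self]

/-- `𝒢`, generated by `A`, is `V`-almost periodic: `V ⊆ Z(A)`, and `t ↦ G(δ_t) x` is almost
periodic for all `x ∈ V`. -/
def IsAlmostPeriodicCDS (𝒢 : OpDist X) (A : X →ₗ.[ℂ] X) (V : Submodule ℂ X) : Prop :=
  (V : Set X) ⊆ solutionSpace A ∧ ∀ x ∈ V, AlmostPeriodic fun t => deltaApply 𝒢 t x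

/-! ### `C`-distribution cosine functions -/

/-- The primitive `G⁻¹` of `G`, `G⁻¹(φ) = -G(I(φ))`. -/
def primitive (N : Normalizer) (G : OpDist X) (φ : TestFn) : X →L[ℂ] X :=
  -G (antideriv N φ)

/-- `G` is a `C`-distribution cosine function. -/
structure IsCDCF (N : Normalizer) (C : X →L[ℂ] X) (G : OpDist X) : Prop where
  /-- `supp G ⊆ [0, ∞)` -/
  support : Distribution.IsVanishingOn G (Ici (0 : ℝ))ᶜ
  comm : ∀ φ, G φ ∘L C = C ∘L G φ
  conv : ∀ φ ψ, primitive N G (conv₀ φ ψ) ∘L C =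
    primitive N G φ ∘L G ψ + G φ ∘L primitive N G ψ
  nondegenerate : ∀ x y,
    (∀ φ ∈ testFnNonneg, G φ x + primitive N G φ y = 0) → x = 0 ∧ y = 0

/-- `A` is the generator of `G`: its graph consists of the `(x, y)` such that
`G⁻¹(φ'') x = G⁻¹(φ) y` for all test functions `φ` supported in `[0, ∞)`. -/
def IsGeneratorCDCF (N : Normalizer) (G : OpDist X) (A : X →ₗ.[ℂ] X) : Prop :=
  ∀ x y, (x, y) ∈ A.graph ↔
    ∀ φ ∈ testFnNonneg, primitive N G (tderiv (tderiv φ)) x = primitive N G φ y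

/-- The operator matrix with rows `(G, G⁻¹)` and `(G' - δ ⊗ C, G)`, evaluated at a test
function, as an operator on `X × X`. -/
def cosineMatrix (N : Normalizer) (C : X →L[ℂ] X) (G : OpDist X) (φ : TestFn) :
    (X × X) →L[ℂ] (X × X) :=
  (G φ ∘L .fst ℂ X X + primitive N G φ ∘L .snd ℂ X X).prod
    ((-G (tderiv φ) - φ 0 • C) ∘L .fst ℂ X X + G φ ∘L .snd ℂ X X)

/-- The value `G(δ_t) x = π₂ (𝒢(δ_t) (0, x))` for a `C`-distribution cosine function `G`, where
`𝒢` is the operator matrix of `G`. -/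
def cosineDeltaApply (N : Normalizer) (C : X →L[ℂ] X) (G : OpDist X) (t : ℝ) (x : X) : X :=
  (deltaApply (cosineMatrix N C G) t (0, x)).2

/-- `G`, generated by `A`, is `V`-almost periodic: `V ⊆ Z₂(A)`, and `t ↦ G(δ_t) x` is almost
periodic for all `x ∈ V`. -/
def IsAlmostPeriodicCDCF (N : Normalizer) (C : X →L[ℂ] X) (G : OpDist X) (A : X →ₗ.[ℂ] X)
    (V : Submodule ℂ X) : Prop :=
  (V : Set X) ⊆ solutionSpace₂ A ∧ ∀ x ∈ V, AlmostPeriodic fun t => cosineDeltaApply N C G t x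

end Operators

end

end CDist

/-!
Let `u` be the mild solution with initial value `x`. For the generator `A` of a `C`-distribution
semigroup `𝒢`, a Duhamel argument shows that `u` is the orbit of `x`: the derivative of
`s ↦ 𝒢(δ_{t-s} * φ) ∫₀ˢ u` is `𝒢(δ_{t-s} * φ) x`, and integrating over `[0, t]` and differentiating
in `t` gives `𝒢(δ_t * φ) x = 𝒢(φ) u(t)`, that is `G(δ_t) x = u(t)`
(`deltaApply_eq_of_mildSolution`).
For cosine functions the same argument with one more integration, applied to the primitive of `G`,
gives `𝒢(δ_t) (0, x) = (∫₀ᵗ u, u(t))` (`cosineDeltaApply_eq_of_mildSolution`). The calculus behind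
this is the differentiability of `a ↦ G(δ_a * φ)` (`hasDerivAt_translation`), which follows from
the finite order of a distribution on compact sets and Taylor's formula.

So `u` is a continuous almost periodic function, and its Bohr means exist
(`AlmostPeriodic.exists_mean`). The graph of `A` is cut out by relations `B₁ x = B₂ y` with bounded
operators `B₁`, `B₂`. Along the solution, `B₁ u` is the first (for cosine functions, second)
derivative of `B₂ u`, and integration by parts shows that the Bohr mean of frequency `r` of a
derivative is `ir` times that of the function (`HasBohrMean.deriv`). Hence the means are
eigenvectors or zero.

For the density of their span, functionals on the quotient by the closed span reduce the claim to
the uniqueness theorem for scalar almost periodic functions: if all Bohr means of `f` vanish, then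
`f 0 = 0` (`AlmostPeriodic.eq_zero_of_bohrMean`). Its proof is a finite version of Bohr's. If
`f 0 ≠ 0`, sample `f` at `N` points of a fine grid. Every short almost period is a shift at which
the cyclic autocorrelation of the samples is at least `const * N`, and these shifts have positive
density; so by Parseval's identity on `ZMod N` some discrete Fourier coefficient is at least
`const * N`, with a constant independent of the grid. But vanishing Bohr means make the averages
`T⁻¹ ∫₀ᵀ e^{-irs} f(s) ds` small uniformly for bounded `r`
(`AlmostPeriodic.exists_uniform_average`), and this makes the discrete coefficients small
compared to `N` once the grid is fine and long (`AlmostPeriodic.dft_sample_le`).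
-/

namespace CDist

/-! ### Almost periodic functions on the half-line -/

section AlmostPeriodic

/-- The character `s ↦ e^{-irs}` of the real line. -/
noncomputable def bohrChar (r s : ℝ) : ℂ := Complex.exp (-(Complex.I * r * s))

theorem norm_bohrChar (r s : ℝ) : ‖bohrChar r s‖ = 1 := by
  rw [bohrChar, show -(Complex.I * r * s) = ((-(r * s) : ℝ) : ℂ) * Complex.I by push_cast; ring,
    Complex.norm_exp_ofReal_mul_I]

theorem bohrChar_add (r s t : ℝ) : bohrChar r (s + t) = bohrChar r s * bohrChar r t := by
  rw [bohrChar, bohrChar, bohrChar, ← Complex.exp_add]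
  push_cast
  ring_nf

theorem bohrChar_zero (r : ℝ) : bohrChar r 0 = 1 := by simp [bohrChar]

theorem bohrChar_zero_left (s : ℝ) : bohrChar 0 s = 1 := by simp [bohrChar]

@[fun_prop]
theorem continuous_bohrChar (r : ℝ) : Continuous (bohrChar r) := by
  unfold bohrChar; fun_prop

theorem hasDerivAt_bohrChar (r s : ℝ) :
    HasDerivAt (bohrChar r) (-(Complex.I * r) * bohrChar r s) s := by
  have h : HasDerivAt (fun s : ℝ => -(Complex.I * r) * (s : ℂ)) (-(Complex.I * r)) s := by
    simpa using (hasDerivAt_id s).ofReal_comp.const_mul (-(Complex.I * r))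
  refine HasDerivAt.congr_deriv (f' := Complex.exp (-(Complex.I * r) * s) * -(Complex.I * r)) ?_ ?_
  · change HasDerivAt (fun s : ℝ => Complex.exp (-(Complex.I * r * s))) _ s
    simpa only [neg_mul] using h.cexp
  · rw [bohrChar, neg_mul (Complex.I * r) (s : ℂ)]
    ring

/-- The character is Lipschitz in the frequency, locally uniformly in time. -/
theorem norm_bohrChar_sub_le (r r' s : ℝ) : ‖bohrChar r s - bohrChar r' s‖ ≤ |r - r'| * |s| := by
  have h : bohrChar r s - bohrChar r' s
      = bohrChar r' s * (Complex.exp (Complex.I * ((-((r - r') * s) : ℝ) : ℂ)) - 1) := by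
    rw [mul_sub, mul_one, bohrChar, bohrChar, ← Complex.exp_add]
    push_cast
    ring_nf
  rw [h, norm_mul, norm_bohrChar, one_mul]
  refine (Real.norm_exp_I_mul_ofReal_sub_one_le (x := -((r - r') * s))).trans ?_
  rw [norm_neg, Real.norm_eq_abs, abs_mul]

variable {X : Type*} [NormedAddCommGroup X]

theorem AlmostPeriodic.exists_bound {f : ℝ → X} (hf : AlmostPeriodic f) (hc : Continuous f) :
    ∃ B : ℝ, 0 < B ∧ ∀ t, 0 ≤ t → ‖f t‖ ≤ B := by
  obtain ⟨l, hl, h⟩ := hf 1 one_pos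
  obtain ⟨M, hM⟩ := (isCompact_Icc (a := (0 : ℝ)) (b := l)).exists_bound_of_continuousOn
    hc.continuousOn
  have hM0 : 0 ≤ M := (norm_nonneg _).trans (hM 0 ⟨le_rfl, hl.le⟩)
  refine ⟨M + 1, by positivity, fun t ht => ?_⟩
  rcases le_total t l with htl | htl
  · exact (hM t ⟨ht, htl⟩).trans (by simp)
  · obtain ⟨τ, hτ, hτ'⟩ := h (t - l) (by linarith)
    have h1 := hτ' (t - τ) (by linarith [hτ.2])
    have h2 := hM (t - τ) ⟨by linarith [hτ.2], by linarith [hτ.1]⟩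
    rw [sub_add_cancel] at h1
    calc ‖f t‖ = ‖(f t - f (t - τ)) + f (t - τ)‖ := by rw [sub_add_cancel]
      _ ≤ 1 + M := (norm_add_le _ _).trans (add_le_add h1 h2)
      _ = M + 1 := add_comm _ _

theorem AlmostPeriodic.exists_modulus {f : ℝ → X} (hf : AlmostPeriodic f) (hc : Continuous f)
    {ε : ℝ} (hε : 0 < ε) :
    ∃ η : ℝ, 0 < η ∧ ∀ s t, 0 ≤ s → 0 ≤ t → |s - t| ≤ η → ‖f s - f t‖ ≤ ε := by
  obtain ⟨l, hl, h⟩ := hf (ε / 4) (by positivity)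
  have huc := (isCompact_Icc (a := (0 : ℝ)) (b := l + 1)).uniformContinuousOn_of_continuous
    hc.continuousOn
  rw [Metric.uniformContinuousOn_iff_le] at huc
  obtain ⟨δ, hδ, hδ'⟩ := huc (ε / 4) (by positivity)
  have key : ∀ s t, 0 ≤ s → s ≤ t → t - s ≤ min δ 1 → ‖f t - f s‖ ≤ ε := by
    intro s t hs hst hd
    have hd1 := hd.trans (min_le_left _ _)
    have hd2 := hd.trans (min_le_right _ _)
    rcases le_total s l with hsl | hsl
    · have := hδ' t ⟨by linarith, by linarith⟩ s ⟨hs, by linarith⟩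
        (by rw [Real.dist_eq, abs_of_nonneg (by linarith)]; exact hd1)
      rw [dist_eq_norm] at this
      linarith
    · obtain ⟨τ, hτ, hτ'⟩ := h (s - l) (by linarith)
      have h1 := hτ' (t - τ) (by linarith [hτ.2])
      have h2 := hτ' (s - τ) (by linarith [hτ.2])
      have h3 := hδ' (t - τ) ⟨by linarith [hτ.2], by linarith [hτ.1]⟩ (s - τ)
        ⟨by linarith [hτ.2], by linarith [hτ.1]⟩
        (by rw [Real.dist_eq, abs_of_nonneg (by linarith)]; linarith)
      rw [sub_add_cancel] at h1 h2
      rw [dist_eq_norm] at h3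
      rw [norm_sub_rev] at h2
      calc ‖f t - f s‖
          = ‖(f t - f (t - τ)) + (f (t - τ) - f (s - τ)) + (f (s - τ) - f s)‖ := by
            congr 1; abel
        _ ≤ ε / 4 + ε / 4 + ε / 4 := norm_add₃_le.trans (by gcongr)
        _ ≤ ε := by linarith
  refine ⟨min δ 1, by positivity, fun s t hs ht hst => ?_⟩
  rcases le_total s t with h' | h'
  · rw [norm_sub_rev]
    exact key s t hs h' (by rwa [abs_sub_comm, abs_of_nonneg (by linarith)] at hst)
  · exact key t s ht h' (by rwa [abs_of_nonneg (by linarith)] at hst)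

/-- The common almost periods of an almost periodic function and of a character are relatively
dense. This is a pigeonhole argument: the almost periods fall into finitely many classes according
to the value of the character, and the difference of two almost periods in the same class is a
common almost period. -/
theorem AlmostPeriodic.exists_common_period {f : ℝ → X} (hf : AlmostPeriodic f) (r : ℝ)
    {ε : ℝ} (hε : 0 < ε) :
    ∃ l : ℝ, 0 < l ∧ ∀ a : ℝ, 0 ≤ a → ∃ τ ∈ Icc a (a + l),
      ‖bohrChar r τ - 1‖ ≤ ε ∧ ∀ t : ℝ, 0 ≤ t → ‖f (t + τ) - f t‖ ≤ ε := by
  obtain ⟨l, hl, h⟩ := hf (ε / 2) (by positivity)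
  set P : Set ℝ := {τ | 0 ≤ τ ∧ ∀ t : ℝ, 0 ≤ t → ‖f (t + τ) - f t‖ ≤ ε / 2} with hP
  have htb : TotallyBounded (bohrChar r '' P) := by
    refine (isCompact_closedBall (0 : ℂ) 1).totallyBounded.subset ?_
    rintro _ ⟨τ, -, rfl⟩
    simp [norm_bohrChar]
  obtain ⟨S, hSP, hSf, hS⟩ := htb.exists_subset (Metric.dist_mem_uniformity hε)
  -- one representative in `P` for each of the finitely many classes
  have hrep : ∃ F' : Finset ℝ, (F' : Set ℝ) ⊆ P ∧
      ∀ τ ∈ P, ∃ σ ∈ F', ‖bohrChar r τ - bohrChar r σ‖ ≤ ε := by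
    obtain ⟨F', hF'P, hF'f, rfl⟩ :=
      (Set.exists_subset_image_finite_and (f := bohrChar r) (s := P) (p := fun t => t = S)).1
        ⟨S, hSP, hSf, rfl⟩
    refine ⟨hF'f.toFinset, by simpa using hF'P, fun τ hτ => ?_⟩
    have := hS (mem_image_of_mem _ hτ)
    simp only [mem_iUnion, mem_ofPred_eq] at this
    obtain ⟨_, ⟨σ, hσ, rfl⟩, hd⟩ := this
    exact ⟨σ, by simpa using hσ, by rw [← dist_eq_norm]; exact le_of_lt hd⟩
  obtain ⟨F', hF'P, hF'⟩ := hrep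
  obtain ⟨b, hb⟩ := F'.bddAbove
  refine ⟨max b 0 + l, by positivity, fun a ha => ?_⟩
  obtain ⟨τ, hτ, hτ'⟩ := h (a + max b 0) (by positivity)
  have hτ0 : 0 ≤ τ := by have := le_max_right b 0; linarith [hτ.1]
  obtain ⟨σ, hσ, hτσ⟩ := hF' τ ⟨hτ0, hτ'⟩
  have hσP := hF'P hσ
  have hσb : σ ≤ max b 0 := (hb hσ).trans (le_max_left _ _)
  refine ⟨τ - σ, ⟨by linarith [hτ.1], by linarith [hτ.2, hσP.1]⟩, ?_, fun t ht => ?_⟩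
  · have : bohrChar r τ - bohrChar r σ = bohrChar r σ * (bohrChar r (τ - σ) - 1) := by
      rw [mul_sub, ← bohrChar_add, mul_one, add_sub_cancel]
    rwa [this, norm_mul, norm_bohrChar, one_mul] at hτσ
  · have h1 := hσP.2 (t + (τ - σ)) (by linarith [hτ.1])
    rw [add_assoc, sub_add_cancel, norm_sub_rev] at h1
    calc ‖f (t + (τ - σ)) - f t‖
        = ‖(f (t + (τ - σ)) - f (t + τ)) + (f (t + τ) - f t)‖ := by rw [sub_add_sub_cancel]
      _ ≤ ε / 2 + ε / 2 := (norm_add_le _ _).trans (add_le_add h1 (hτ' t ht))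
      _ = ε := add_halves ε

variable [NormedSpace ℂ X]

theorem AlmostPeriodic.bohrChar_smul {f : ℝ → X} (hf : AlmostPeriodic f) (hc : Continuous f)
    (r : ℝ) : AlmostPeriodic fun s => bohrChar r s • f s := by
  intro ε hε
  obtain ⟨B, hB, hfB⟩ := hf.exists_bound hc
  obtain ⟨l, hl, h⟩ := hf.exists_common_period r (ε := ε / (1 + B)) (by positivity)
  refine ⟨l, hl, fun a ha => ?_⟩
  obtain ⟨τ, hτ, h1, h2⟩ := h a ha
  refine ⟨τ, hτ, fun t ht => ?_⟩
  have : bohrChar r (t + τ) • f (t + τ) - bohrChar r t • f t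
      = bohrChar r (t + τ) • (f (t + τ) - f t) + (bohrChar r t * (bohrChar r τ - 1)) • f t := by
    rw [bohrChar_add, smul_sub, mul_sub, sub_smul, mul_one]; abel
  rw [this]
  refine (norm_add_le _ _).trans ?_
  rw [norm_smul, norm_smul, norm_mul, norm_bohrChar, norm_bohrChar, one_mul, one_mul]
  calc ‖f (t + τ) - f t‖ + ‖bohrChar r τ - 1‖ * ‖f t‖
      ≤ ε / (1 + B) + ε / (1 + B) * B := by gcongr; exacts [h2 t ht, hfB t ht]
    _ = ε := by field_simp

/-- The averages of an almost periodic function over windows of a fixed large length almost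
do not depend on the position of the window. -/
theorem AlmostPeriodic.integral_window {g : ℝ → X} (hg : AlmostPeriodic g) (hc : Continuous g)
    {ε : ℝ} (hε : 0 < ε) :
    ∃ T₀ : ℝ, 0 < T₀ ∧ ∀ T, T₀ ≤ T → ∀ a, 0 ≤ a →
      ‖(∫ s in a..a + T, g s) - ∫ s in (0 : ℝ)..T, g s‖ ≤ ε * T := by
  obtain ⟨B, hB, hgB⟩ := hg.exists_bound hc
  obtain ⟨l, hl, h⟩ := hg (ε / 2) (by positivity)
  refine ⟨4 * l * B / ε, by positivity, fun T hT a ha => ?_⟩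
  have hT0 : 0 < T := lt_of_lt_of_le (by positivity) hT
  rw [div_le_iff₀ hε] at hT
  obtain ⟨τ, hτ, hτ'⟩ := h a ha
  have hi : ∀ x y, IntervalIntegrable g volume x y := fun x y => hc.intervalIntegrable x y
  have e1 : (∫ s in a..a + T, g s) - ∫ s in (0 : ℝ)..T, g s
      = (∫ s in a..τ, g s)
        + ((∫ s in (0 : ℝ)..T, (g (s + τ) - g s)) - ∫ s in a + T..τ + T, g s) := by
    have h0 : (∫ s in (0 : ℝ)..T, (g (s + τ) - g s))
        = (∫ s in τ..τ + T, g s) - ∫ s in (0 : ℝ)..T, g s := by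
      rw [intervalIntegral.integral_sub
        (Continuous.intervalIntegrable (by fun_prop) _ _) (hi _ _),
        intervalIntegral.integral_comp_add_right (fun s => g s), zero_add, add_comm T τ]
    have h1 := intervalIntegral.integral_add_adjacent_intervals (hi a τ) (hi τ (τ + T))
    have h2 := intervalIntegral.integral_add_adjacent_intervals (hi a (a + T)) (hi (a + T) (τ + T))
    rw [← h2, ← eq_sub_iff_add_eq'] at h1
    rw [h0, h1]
    abel
  have b1 : ‖∫ s in a..τ, g s‖ ≤ B * l := by
    refine (intervalIntegral.norm_integral_le_of_norm_le_const fun s hs => hgB s ?_).trans ?_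
    · rw [uIoc_of_le hτ.1] at hs; linarith [hs.1]
    · rw [abs_of_nonneg (by linarith [hτ.1])]; gcongr; linarith [hτ.2]
  have b2 : ‖∫ s in a + T..τ + T, g s‖ ≤ B * l := by
    refine (intervalIntegral.norm_integral_le_of_norm_le_const fun s hs => hgB s ?_).trans ?_
    · rw [uIoc_of_le (by linarith [hτ.1])] at hs; linarith [hs.1]
    · rw [abs_of_nonneg (by linarith [hτ.1])]; gcongr; linarith [hτ.2]
  have b3 : ‖∫ s in (0 : ℝ)..T, (g (s + τ) - g s)‖ ≤ ε / 2 * T := by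
    refine (intervalIntegral.norm_integral_le_of_norm_le_const fun s hs => hτ' s ?_).trans ?_
    · rw [uIoc_of_le hT0.le] at hs; exact hs.1.le
    · rw [sub_zero, abs_of_pos hT0]
  rw [e1]
  refine (norm_add_le _ _).trans ?_
  have := norm_sub_le (∫ s in (0 : ℝ)..T, (g (s + τ) - g s)) (∫ s in a + T..τ + T, g s)
  nlinarith

/-- If the integral over every window of length `T₀` is small, then so is the average over every
long interval; the error `B * T₀` comes from the last, incomplete window. -/
theorem norm_integral_le_of_window {g : ℝ → X} (hc : Continuous g) {B T₀ ε : ℝ} (hT₀ : 0 < T₀)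
    (hB : ∀ t, 0 ≤ t → ‖g t‖ ≤ B) (h : ∀ a, 0 ≤ a → ‖∫ s in a..a + T₀, g s‖ ≤ ε * T₀)
    {S : ℝ} (hS : 0 ≤ S) : ‖∫ s in (0 : ℝ)..S, g s‖ ≤ ε * S + B * T₀ := by
  have hi : ∀ x y, IntervalIntegrable g volume x y := fun x y => hc.intervalIntegrable x y
  have hε : 0 ≤ ε := nonneg_of_mul_nonneg_left ((norm_nonneg _).trans (h 0 le_rfl)) hT₀
  have hB0 : 0 ≤ B := (norm_nonneg _).trans (hB 0 le_rfl)
  have hn : ∀ n : ℕ, ‖∫ s in (0 : ℝ)..n * T₀, g s‖ ≤ ε * (n * T₀) := by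
    intro n
    induction n with
    | zero => simp
    | succ n ih =>
      rw [← intervalIntegral.integral_add_adjacent_intervals (hi 0 (n * T₀)) (hi _ _)]
      have := h (n * T₀) (by positivity)
      push_cast
      rw [add_mul, one_mul, mul_add]
      exact (norm_add_le _ _).trans (add_le_add ih this)
  set n := ⌊S / T₀⌋₊
  have h1 : n * T₀ ≤ S := (le_div_iff₀ hT₀).1 (Nat.floor_le (by positivity))
  have h2 : S ≤ n * T₀ + T₀ := by
    have := (Nat.lt_floor_add_one (S / T₀)).le
    rw [div_le_iff₀ hT₀] at this
    linarith
  rw [← intervalIntegral.integral_add_adjacent_intervals (hi 0 (n * T₀)) (hi _ _)]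
  refine (norm_add_le _ _).trans (add_le_add ((hn n).trans (by gcongr)) ?_)
  refine (intervalIntegral.norm_integral_le_of_norm_le_const fun s hs => hB s ?_).trans ?_
  · rw [uIoc_of_le h1] at hs
    exact le_trans (by positivity) hs.1.le
  · rw [abs_of_nonneg (by linarith)]
    gcongr
    linarith

/-- An almost periodic function has a mean. -/
theorem AlmostPeriodic.exists_mean [CompleteSpace X] {g : ℝ → X} (hg : AlmostPeriodic g)
    (hc : Continuous g) : ∃ p, Tendsto (fun T : ℝ => T⁻¹ • ∫ s in (0 : ℝ)..T, g s) atTop (𝓝 p) := by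
  obtain ⟨B, hB, hgB⟩ := hg.exists_bound hc
  refine cauchySeq_tendsto_of_complete (Metric.cauchySeq_iff'.2 fun ε hε => ?_)
  obtain ⟨T, hT, h⟩ := hg.integral_window hc (ε := ε / 8) (by positivity)
  set c : X := T⁻¹ • ∫ s in (0 : ℝ)..T, g s with hcdef
  have hcT : T • c = ∫ s in (0 : ℝ)..T, g s := by
    rw [hcdef, smul_smul, mul_inv_cancel₀ hT.ne', one_smul]
  have hci : ∀ a b : ℝ, ∫ s in a..b, (g s - c) = (∫ s in a..b, g s) - (b - a) • c := fun a b => by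
    rw [intervalIntegral.integral_sub (hc.intervalIntegrable _ _)
      (continuous_const.intervalIntegrable _ _), intervalIntegral.integral_const]
  have key : ∀ S, 0 ≤ S → ‖(∫ s in (0 : ℝ)..S, g s) - S • c‖ ≤ ε / 8 * S + (B + ‖c‖) * T := by
    intro S hS
    have := norm_integral_le_of_window (g := fun s => g s - c) (by fun_prop) (B := B + ‖c‖)
      (ε := ε / 8) hT (fun t ht => (norm_sub_le _ _).trans (by gcongr; exact hgB t ht))
      (fun a ha => by
        rw [hci, add_sub_cancel_left, hcT]
        exact h T le_rfl a ha) hS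
    rwa [hci, sub_zero] at this
  have key2 : ∀ S, max 1 ((B + ‖c‖) * T * 8 / ε) ≤ S →
      ‖S⁻¹ • (∫ s in (0 : ℝ)..S, g s) - c‖ ≤ ε / 4 := by
    intro S hS
    have hS0 : 0 < S := one_pos.trans_le ((le_max_left _ _).trans hS)
    have h1 := (le_max_right _ _).trans hS
    rw [div_le_iff₀ hε] at h1
    have : S⁻¹ • (∫ s in (0 : ℝ)..S, g s) - c = S⁻¹ • ((∫ s in (0 : ℝ)..S, g s) - S • c) := by
      rw [smul_sub, smul_smul, inv_mul_cancel₀ hS0.ne', one_smul]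
    rw [this, norm_smul, norm_inv, Real.norm_of_nonneg hS0.le, inv_mul_le_iff₀ hS0]
    have := key S hS0.le
    linarith
  refine ⟨max 1 ((B + ‖c‖) * T * 8 / ε), fun S hS => ?_⟩
  have h1 := key2 S hS
  have h2 := key2 _ le_rfl
  rw [← dist_eq_norm] at h1 h2
  exact (dist_triangle_right _ _ c).trans_lt (by linarith)

/-- If the mean of an almost periodic function vanishes, then so does the limit of its averages,
uniformly in the position of the window. -/
theorem AlmostPeriodic.exists_window_of_mean_zero {g : ℝ → X} (hg : AlmostPeriodic g)
    (hc : Continuous g) (h0 : Tendsto (fun T : ℝ => T⁻¹ • ∫ s in (0 : ℝ)..T, g s) atTop (𝓝 0))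
    {ε : ℝ} (hε : 0 < ε) :
    ∃ T, 0 < T ∧ ∀ a, 0 ≤ a → ‖∫ s in a..a + T, g s‖ ≤ ε * T := by
  obtain ⟨T₁, hT₁, h1⟩ := hg.integral_window hc (half_pos hε)
  have h2 := h0.norm.eventually_le_const (u := ε / 2) (by simpa using half_pos hε)
  obtain ⟨T, hT, hT'⟩ := (h2.and (eventually_ge_atTop T₁)).exists
  have hTp := hT₁.trans_le hT'
  rw [norm_smul, norm_inv, Real.norm_of_nonneg hTp.le, inv_mul_le_iff₀ hTp] at hT
  refine ⟨T, hTp, fun a ha => ?_⟩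
  have := h1 T hT' a ha
  have h3 := norm_add_le ((∫ s in a..a + T, g s) - ∫ s in (0 : ℝ)..T, g s) (∫ s in (0 : ℝ)..T, g s)
  rw [sub_add_cancel] at h3
  linarith

/-- If all Fourier coefficients of an almost periodic function vanish, then its Fourier averages
tend to zero uniformly on bounded sets of frequencies. -/
theorem AlmostPeriodic.exists_uniform_average {f : ℝ → X} (hf : AlmostPeriodic f)
    (hc : Continuous f) (h0 : ∀ r, HasBohrMean f r 0) (R : ℝ) {ε : ℝ} (hε : 0 < ε) :
    ∃ T₁ : ℝ, ∀ T, T₁ ≤ T → ∀ r ∈ Icc (-R) R,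
      ‖∫ s in (0 : ℝ)..T, bohrChar r s • f s‖ ≤ ε * T := by
  obtain ⟨B, hB, hfB⟩ := hf.exists_bound hc
  have hgB : ∀ r t, 0 ≤ t → ‖bohrChar r t • f t‖ ≤ B := fun r t ht => by
    rw [norm_smul, norm_bohrChar, one_mul]; exact hfB t ht
  refine isCompact_Icc.induction_on
    (p := fun s => ∃ T₁ : ℝ, ∀ T, T₁ ≤ T → ∀ r ∈ s,
      ‖∫ s in (0 : ℝ)..T, bohrChar r s • f s‖ ≤ ε * T) ?_ ?_ ?_ ?_
  · simp
  · rintro s t hst ⟨T₁, h⟩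
    exact ⟨T₁, fun T hT r hr => h T hT r (hst hr)⟩
  · rintro s t ⟨T₁, h1⟩ ⟨T₂, h2⟩
    refine ⟨max T₁ T₂, fun T hT r hr => ?_⟩
    rcases hr with hr | hr
    exacts [h1 T ((le_max_left _ _).trans hT) r hr, h2 T ((le_max_right _ _).trans hT) r hr]
  intro r₀ _
  obtain ⟨T₀, hT₀, h⟩ := (hf.bohrChar_smul hc r₀).exists_window_of_mean_zero
    (by fun_prop) (h0 r₀) (ε := ε / 4) (by positivity)
  set δ := ε / (4 * B * T₀) with hδ
  have hδ0 : 0 < δ := by positivity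
  refine ⟨Metric.closedBall r₀ δ, mem_nhdsWithin_of_mem_nhds (Metric.closedBall_mem_nhds _ hδ0),
    2 * B * T₀ / ε, fun T hT r hr => ?_⟩
  rw [div_le_iff₀ hε] at hT
  have hT0 : 0 ≤ T := by
    have : 0 < T * ε := lt_of_lt_of_le (by positivity) hT
    exact (pos_of_mul_pos_left this hε.le).le
  rw [Metric.mem_closedBall, Real.dist_eq] at hr
  -- move the window to the origin, where the character varies little with the frequency
  have hshift : ∀ r a, ∫ s in a..a + T₀, bohrChar r s • f s
      = bohrChar r a • ∫ s in (0 : ℝ)..T₀, bohrChar r s • f (a + s) := by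
    intro r a
    rw [← intervalIntegral.integral_smul]
    have := intervalIntegral.integral_comp_add_left (fun s => bohrChar r s • f s) a
      (a := 0) (b := T₀)
    rw [add_zero] at this
    rw [← this]
    simp_rw [bohrChar_add, smul_smul]
  have hw : ∀ a, 0 ≤ a → ‖∫ s in a..a + T₀, bohrChar r s • f s‖ ≤ ε / 2 * T₀ := by
    intro a ha
    have h1 := h a ha
    rw [hshift, norm_smul, norm_bohrChar, one_mul] at h1 ⊢
    have h2 : ‖(∫ s in (0 : ℝ)..T₀, bohrChar r s • f (a + s))
        - ∫ s in (0 : ℝ)..T₀, bohrChar r₀ s • f (a + s)‖ ≤ δ * T₀ * B * |T₀ - 0| := by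
      rw [← intervalIntegral.integral_sub (Continuous.intervalIntegrable (by fun_prop) _ _)
        (Continuous.intervalIntegrable (by fun_prop) _ _)]
      refine intervalIntegral.norm_integral_le_of_norm_le_const fun s hs => ?_
      rw [uIoc_of_le hT₀.le] at hs
      rw [← sub_smul, norm_smul]
      gcongr
      · refine (norm_bohrChar_sub_le _ _ _).trans ?_
        rw [abs_of_pos hs.1]
        exact mul_le_mul hr hs.2 hs.1.le hδ0.le
      · exact hfB _ (by linarith [hs.1])
    have h3 : δ * T₀ * B * |T₀ - 0| = ε / 4 * T₀ := by
      rw [sub_zero, abs_of_pos hT₀, hδ]; field_simp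
    rw [h3] at h2
    have h4 := norm_add_le ((∫ s in (0 : ℝ)..T₀, bohrChar r s • f (a + s))
        - ∫ s in (0 : ℝ)..T₀, bohrChar r₀ s • f (a + s))
        (∫ s in (0 : ℝ)..T₀, bohrChar r₀ s • f (a + s))
    rw [sub_add_cancel] at h4
    linarith
  have := norm_integral_le_of_window (g := fun s => bohrChar r s • f s) (by fun_prop) hT₀
    (hgB r) hw hT0
  linarith

end AlmostPeriodic

/-! ### Autocorrelations on finite cyclic groups -/

section Cyclic

open Finset ZMod
open scoped ComplexConjugate

variable {N : ℕ} [NeZero N]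

theorem sum_norm_sq_dft (x : ZMod N → ℂ) :
    ∑ k, ‖ZMod.dft x k‖ ^ 2 = N * ∑ j, ‖x j‖ ^ 2 := by
  have h : ∀ k, ((‖ZMod.dft x k‖ ^ 2 : ℝ) : ℂ)
      = ∑ j, ∑ i, x j * conj (x i) * stdAddChar (k * (i - j)) := by
    intro k
    rw [Complex.ofReal_pow, ← Complex.mul_conj', ZMod.dft_apply, map_sum, sum_mul_sum]
    refine sum_congr rfl fun j _ => sum_congr rfl fun i _ => ?_
    rw [smul_eq_mul, smul_eq_mul, map_mul, ← AddChar.map_neg_eq_conj, neg_neg,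
      show k * (i - j) = -(j * k) + i * k by ring, AddChar.map_add_eq_mul]
    ring
  have : ((∑ k, ‖ZMod.dft x k‖ ^ 2 : ℝ) : ℂ) = ((N * ∑ j, ‖x j‖ ^ 2 : ℝ) : ℂ) := by
    rw [Complex.ofReal_sum, sum_congr rfl fun k _ => h k, sum_comm]
    push_cast
    rw [mul_sum]
    refine sum_congr rfl fun j _ => ?_
    rw [sum_comm]
    simp_rw [← mul_sum, AddChar.sum_mulShift _ (isPrimitive_stdAddChar N), sub_eq_zero]
    simp [Complex.mul_conj', mul_comm]
  exact_mod_cast this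

/-- The autocorrelation of a function on a cyclic group. -/
noncomputable def autocorr (x : ZMod N → ℂ) (m : ZMod N) : ℂ := ∑ j, x (j + m) * conj (x j)

theorem dft_autocorr (x : ZMod N → ℂ) (k : ZMod N) :
    ZMod.dft (autocorr x) k = ZMod.dft x k * conj (ZMod.dft x k) := by
  simp_rw [ZMod.dft_apply, autocorr, smul_eq_mul, mul_sum]
  rw [sum_comm, map_sum, mul_sum]
  refine sum_congr rfl fun j _ => ?_
  rw [sum_mul]
  refine Fintype.sum_equiv (Equiv.addLeft j) _ _ fun m => ?_
  rw [map_mul, ← AddChar.map_neg_eq_conj, neg_neg, Equiv.coe_addLeft,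
    show -(m * k) = -((j + m) * k) + j * k by ring, AddChar.map_add_eq_mul]
  ring

/-- A function on a cyclic group with small Fourier coefficients has a small autocorrelation. -/
theorem sum_norm_sq_autocorr_le (x : ZMod N → ℂ) {D : ℝ} (hD : ∀ k, ‖ZMod.dft x k‖ ≤ D) :
    ∑ m, ‖autocorr x m‖ ^ 2 ≤ D ^ 2 * ∑ j, ‖x j‖ ^ 2 := by
  have hN : (0 : ℝ) < N := by exact_mod_cast Nat.pos_of_ne_zero (NeZero.ne N)
  refine le_of_mul_le_mul_left ?_ hN
  rw [← sum_norm_sq_dft, mul_left_comm, ← sum_norm_sq_dft, mul_sum]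
  refine sum_le_sum fun k _ => ?_
  rw [dft_autocorr, norm_mul, RCLike.norm_conj, mul_pow]
  gcongr
  exact hD k

theorem sum_comp_val {R : Type*} [AddCommMonoid R] (g : ℕ → R) :
    ∑ j : ZMod N, g j.val = ∑ n ∈ range N, g n := by
  refine sum_nbij' ZMod.val (fun n => (n : ZMod N)) ?_ ?_ ?_ ?_ ?_
  · intro j _; simpa using ZMod.val_lt j
  · simp
  · intro j _; simp
  · intro n hn; exact ZMod.val_cast_of_lt (by simpa using hn)
  · simp

end Cyclic

/-! ### Uniqueness of Fourier coefficients -/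

section Uniqueness

open scoped ComplexConjugate

/-- The integral over one grid cell of a character whose frequency is at most the Nyquist frequency
`π / δ` does not degenerate. -/
theorem half_le_norm_integral_bohrChar {r δ : ℝ} (hδ : 0 < δ) (h : |r| * δ ≤ Real.pi) :
    δ / 2 ≤ ‖∫ u in (0 : ℝ)..δ, bohrChar r u‖ := by
  rcases eq_or_ne r 0 with rfl | hr
  · simp only [bohrChar_zero_left, intervalIntegral.integral_const, sub_zero, norm_smul, norm_one,
      Real.norm_eq_abs, abs_of_pos hδ]
    linarith
  have hr' : 0 < |r| := abs_pos.2 hr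
  have h1 : (∫ u in (0 : ℝ)..δ, -(Complex.I * r) * bohrChar r u) = bohrChar r δ - bohrChar r 0 :=
    intervalIntegral.integral_eq_sub_of_hasDerivAt (fun u _ => hasDerivAt_bohrChar r u)
      (Continuous.intervalIntegrable (by fun_prop) _ _)
  rw [intervalIntegral.integral_const_mul, bohrChar_zero, bohrChar,
    show -(Complex.I * r * δ) = Complex.I * ((-(r * δ) : ℝ) : ℂ) by push_cast; ring] at h1
  have h2 := congrArg norm h1
  rw [Complex.norm_exp_I_mul_ofReal_sub_one, norm_mul, norm_neg, norm_mul, Complex.norm_I, one_mul,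
    Complex.norm_real, norm_mul, Real.norm_eq_abs, Real.norm_eq_abs, Real.norm_eq_abs,
    neg_div, Real.sin_neg, abs_neg, abs_two] at h2
  have h3 : |Real.sin (r * δ / 2)| = |Real.sin (|r| * δ / 2)| := by
    rcases abs_cases r with ⟨h, -⟩ | ⟨h, -⟩
    · rw [h]
    · rw [h, neg_mul, neg_div, Real.sin_neg, abs_neg]
  have h4 : 2 / Real.pi * (|r| * δ / 2) ≤ Real.sin (|r| * δ / 2) :=
    Real.mul_le_sin (by positivity) (by linarith)
  have h5 := h4.trans (le_abs_self _)
  rw [h3] at h2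
  have h6 : 1 / 2 ≤ 2 / Real.pi := by
    rw [div_le_div_iff₀ two_pos Real.pi_pos]; linarith [Real.pi_le_four]
  have h7 : 1 / 2 * (|r| * δ / 2) ≤ 2 / Real.pi * (|r| * δ / 2) := by gcongr
  refine le_of_mul_le_mul_left ?_ hr'
  rw [h2]
  linarith

/-- The samples of an almost periodic function with vanishing Fourier coefficients, taken on a fine
grid along a long interval, have small discrete Fourier coefficients. -/
theorem AlmostPeriodic.dft_sample_le {f : ℝ → ℂ} (hf : AlmostPeriodic f) (hc : Continuous f)
    (h0 : ∀ r, HasBohrMean f r 0) {e : ℝ} (he : 0 < e) :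
    ∃ δ₀ : ℝ, 0 < δ₀ ∧ ∀ δ, 0 < δ → δ ≤ δ₀ → ∃ N₀ : ℕ, ∀ (N : ℕ) [NeZero N], N₀ ≤ N →
      ∀ k : ZMod N, ‖ZMod.dft (fun j : ZMod N => f (j.val * δ)) k‖ ≤ e * N := by
  obtain ⟨η, hη, hη'⟩ := hf.exists_modulus hc (ε := e / 4) (by positivity)
  refine ⟨η, hη, fun δ hδ hδη => ?_⟩
  obtain ⟨T₁, hT₁⟩ := hf.exists_uniform_average hc h0 (Real.pi / δ) (ε := e / 4) (by positivity)
  refine ⟨⌈T₁ / δ⌉₊, fun N _ hN k => ?_⟩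
  have hN0 : (0 : ℝ) < N := by exact_mod_cast Nat.pos_of_ne_zero (NeZero.ne N)
  have hNT : T₁ ≤ N * δ := (div_le_iff₀ hδ).1 ((Nat.le_ceil _).trans (by exact_mod_cast hN))
  -- the representative of the frequency `k` for which `|r δ| ≤ π`
  set r : ℝ := 2 * Real.pi * k.valMinAbs / (N * δ) with hr
  have hk : |(k.valMinAbs : ℝ)| ≤ N / 2 := by
    have h1 : (k.valMinAbs.natAbs : ℝ) ≤ ((N / 2 : ℕ) : ℝ) := by
      exact_mod_cast ZMod.natAbs_valMinAbs_le k
    rw [Nat.cast_natAbs, Int.cast_abs] at h1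
    exact h1.trans Nat.cast_div_le
  have hrδ : |r| ≤ Real.pi / δ := by
    rw [hr, abs_div, abs_mul, abs_of_pos (by positivity : 0 < 2 * Real.pi),
      abs_of_pos (by positivity : 0 < N * δ), div_le_div_iff₀ (by positivity) hδ]
    have : 2 * Real.pi * |(k.valMinAbs : ℝ)| * δ ≤ 2 * Real.pi * (N / 2) * δ := by gcongr
    linarith
  have hchar : ∀ j : ZMod N, ZMod.stdAddChar (-(j * k)) = bohrChar r (j.val * δ) := by
    intro j
    have : -(j * k) = ((-(j.val * k.valMinAbs) : ℤ) : ZMod N) := by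
      push_cast
      simp
    rw [this, ZMod.stdAddChar_coe, bohrChar, hr]
    congr 1
    have h1 : (N : ℂ) ≠ 0 := by exact_mod_cast hN0.ne'
    have h2 : (δ : ℂ) ≠ 0 := by exact_mod_cast hδ.ne'
    push_cast
    field_simp
  set κ : ℂ := ∫ u in (0 : ℝ)..δ, bohrChar r u with hκ
  have hκδ : δ / 2 ≤ ‖κ‖ := half_le_norm_integral_bohrChar hδ (by rwa [← le_div_iff₀ hδ])
  have hgc : Continuous fun s => bohrChar r s • f s := by fun_prop
  have hsplit : (∫ s in (0 : ℝ)..N * δ, bohrChar r s • f s)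
      = ∑ n ∈ Finset.range N,
          bohrChar r (n * δ) • ∫ u in (0 : ℝ)..δ, bohrChar r u • f (n * δ + u) := by
    have := intervalIntegral.sum_integral_adjacent_intervals (μ := volume)
      (f := fun s => bohrChar r s • f s) (a := fun n : ℕ => (n : ℝ) * δ) (n := N)
      fun k _ => hgc.intervalIntegrable _ _
    rw [Nat.cast_zero, zero_mul] at this
    rw [← this]
    refine Finset.sum_congr rfl fun n _ => ?_
    rw [← intervalIntegral.integral_smul, show ((n + 1 : ℕ) : ℝ) * δ = n * δ + δ by push_cast; ring]
    have h := intervalIntegral.integral_comp_add_left (fun s => bohrChar r s • f s) (n * δ)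
      (a := 0) (b := δ)
    rw [add_zero] at h
    rw [← h]
    simp_rw [bohrChar_add, smul_smul]
  have hdft : κ * ZMod.dft (fun j : ZMod N => f (j.val * δ)) k
      = ∑ n ∈ Finset.range N, bohrChar r (n * δ) • ∫ u in (0 : ℝ)..δ, bohrChar r u • f (n * δ) := by
    simp_rw [ZMod.dft_apply, hchar]
    rw [sum_comp_val (fun n => bohrChar r (n * δ) • f (n * δ)), Finset.mul_sum]
    refine Finset.sum_congr rfl fun n _ => ?_
    rw [intervalIntegral.integral_smul_const, smul_eq_mul, smul_eq_mul, smul_eq_mul]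
    ring
  have hdiff : ‖κ * ZMod.dft (fun j : ZMod N => f (j.val * δ)) k
      - ∫ s in (0 : ℝ)..N * δ, bohrChar r s • f s‖ ≤ N * (e / 4 * δ) := by
    rw [hdft, hsplit, ← Finset.sum_sub_distrib]
    refine (norm_sum_le _ _).trans ?_
    refine (Finset.sum_le_card_nsmul _ _ (e / 4 * δ) fun n _ => ?_).trans (by simp)
    rw [← smul_sub, norm_smul, norm_bohrChar, one_mul,
      ← intervalIntegral.integral_sub (Continuous.intervalIntegrable (by fun_prop) _ _)
        (Continuous.intervalIntegrable (by fun_prop) _ _)]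
    refine (intervalIntegral.norm_integral_le_of_norm_le_const (C := e / 4) fun u hu => ?_).trans ?_
    · rw [uIoc_of_le hδ.le] at hu
      rw [← smul_sub, norm_smul, norm_bohrChar, one_mul]
      refine hη' _ _ (by positivity) (add_nonneg (by positivity) hu.1.le) ?_
      rw [sub_add_cancel_left, abs_neg, abs_of_pos hu.1]
      exact hu.2.trans hδη
    · rw [sub_zero, abs_of_pos hδ]
  have hint := hT₁ (N * δ) hNT r (abs_le.1 hrδ)
  have h1 := norm_add_le (κ * ZMod.dft (fun j : ZMod N => f (j.val * δ)) k
      - ∫ s in (0 : ℝ)..N * δ, bohrChar r s • f s) (∫ s in (0 : ℝ)..N * δ, bohrChar r s • f s)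
  rw [sub_add_cancel, norm_mul] at h1
  have h2 := mul_le_mul_of_nonneg_right hκδ
    (norm_nonneg (ZMod.dft (fun j : ZMod N => f (j.val * δ)) k))
  refine le_of_mul_le_mul_left ?_ (half_pos hδ)
  linarith

/-- If every window of length `w` contains a block of `p` consecutive elements of `S`, then `S` has
lower density at least `p / w`. -/
theorem mul_le_count_of_window {S : ℕ → Prop} [DecidablePred S] {p w : ℕ}
    (h : ∀ a, ∃ n, a ≤ n ∧ n + p ≤ a + w ∧ ∀ i < p, S (n + i)) (J : ℕ) :
    J * p ≤ Nat.count S (J * w) := by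
  induction J with
  | zero => simp
  | succ J ih =>
    obtain ⟨n, h1, h2, h3⟩ := h (J * w)
    have h4 : Nat.count S (n + p) = Nat.count S n + p := by
      rw [Nat.count_add, Nat.count_of_forall (fun {i} hi => h3 i hi)]
    have h5 := Nat.count_monotone S h1
    have h6 := Nat.count_monotone S h2
    rw [Nat.succ_mul, Nat.succ_mul]
    omega

open Classical in
/-- The almost periods of an almost periodic function have a positive lower density on every fine
grid, and this density is bounded below independently of the grid. -/
theorem AlmostPeriodic.le_count_periods {X : Type*} [NormedAddCommGroup X] {f : ℝ → X}
    (hf : AlmostPeriodic f) (hc : Continuous f) {ε : ℝ} (hε : 0 < ε) :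
    ∃ c : ℝ, 0 < c ∧ ∃ δ₀ : ℝ, 0 < δ₀ ∧ ∀ δ, 0 < δ → δ ≤ δ₀ → ∃ M₀ : ℕ, ∀ M, M₀ ≤ M →
      c * M ≤ Nat.count (fun n : ℕ => ∀ t, 0 ≤ t → ‖f (t + n * δ) - f t‖ ≤ ε) M := by
  obtain ⟨l, hl, h⟩ := hf (ε / 2) (by positivity)
  obtain ⟨η, hη, hη'⟩ := hf.exists_modulus hc (half_pos hε)
  refine ⟨η / (4 * (l + 3 * η)), by positivity, η, hη, fun δ hδ hδη => ?_⟩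
  set p := ⌊η / δ⌋₊ with hp
  set w := ⌈(l + η) / δ⌉₊ + 1 with hw
  have hp1 : (p : ℝ) ≤ η / δ := Nat.floor_le (by positivity)
  have hwindow : ∀ a : ℕ, ∃ n, a ≤ n ∧ n + p ≤ a + w ∧
      ∀ i < p, ∀ t, 0 ≤ t → ‖f (t + (n + i : ℕ) * δ) - f t‖ ≤ ε := by
    intro a
    obtain ⟨τ, hτ, hτ'⟩ := h (a * δ) (by positivity)
    have hτ0 : 0 ≤ τ := le_trans (by positivity) hτ.1
    have hn1 : τ / δ ≤ ⌈τ / δ⌉₊ := Nat.le_ceil _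
    have hn2 : (⌈τ / δ⌉₊ : ℝ) < τ / δ + 1 := Nat.ceil_lt_add_one (by positivity)
    refine ⟨⌈τ / δ⌉₊, ?_, ?_, fun i hi t ht => ?_⟩
    · have : (a : ℝ) ≤ ⌈τ / δ⌉₊ := ((le_div_iff₀ hδ).2 hτ.1).trans hn1
      exact_mod_cast this
    · have h1 : τ / δ ≤ a + l / δ := by
        rw [div_le_iff₀ hδ, add_mul, div_mul_cancel₀ _ hδ.ne']
        exact hτ.2
      have h2 : (l + η) / δ ≤ ⌈(l + η) / δ⌉₊ := Nat.le_ceil _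
      have h3 : ((⌈τ / δ⌉₊ + p : ℕ) : ℝ) < ((a + w : ℕ) : ℝ) := by
        rw [hw]
        push_cast
        have h4 := add_div l η δ
        linarith
      exact le_of_lt (by exact_mod_cast h3)
    · have h1 : τ ≤ (⌈τ / δ⌉₊ + i : ℕ) * δ := by
        have := (div_le_iff₀ hδ).1 hn1
        push_cast
        nlinarith [mul_nonneg (Nat.cast_nonneg (α := ℝ) i) hδ.le]
      have h2 : (⌈τ / δ⌉₊ + i : ℕ) * δ ≤ τ + η := by
        have hip : (i : ℝ) + 1 ≤ p := by exact_mod_cast hi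
        have : ((⌈τ / δ⌉₊ + i : ℕ) : ℝ) ≤ (τ + η) / δ := by
          push_cast
          rw [add_div]
          linarith
        exact (le_div_iff₀ hδ).1 this
      have h3 := hη' (t + (⌈τ / δ⌉₊ + i : ℕ) * δ) (t + τ) (by linarith) (by linarith)
        (by rw [add_sub_add_left_eq_sub, abs_of_nonneg (by linarith)]; linarith)
      calc _ = ‖(f (t + (⌈τ / δ⌉₊ + i : ℕ) * δ) - f (t + τ)) + (f (t + τ) - f t)‖ := by
            rw [sub_add_sub_cancel]
        _ ≤ ε / 2 + ε / 2 := (norm_add_le _ _).trans (add_le_add h3 (hτ' t ht))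
        _ = ε := add_halves ε
  refine ⟨w, fun M hM => ?_⟩
  have hJ := mul_le_count_of_window
    (S := fun n : ℕ => ∀ t, 0 ≤ t → ‖f (t + n * δ) - f t‖ ≤ ε) hwindow (M / w)
  have hmono := Nat.count_monotone
    (fun n : ℕ => ∀ t, 0 ≤ t → ‖f (t + n * δ) - f t‖ ≤ ε) (Nat.div_mul_le_self M w)
  have hw0 : 0 < w := Nat.succ_pos _
  have hJ1 : (M : ℝ) ≤ 2 * (M / w : ℕ) * w := by
    have h1 : M < (M / w) * w + w := Nat.lt_div_mul_add hw0
    have h2 : 1 ≤ M / w := (Nat.one_le_div_iff hw0).2 hM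
    have h3 : M ≤ 2 * (M / w) * w := by nlinarith
    exact_mod_cast h3
  have hp2 : η / δ ≤ 2 * p := by
    have h1 : 1 ≤ η / δ := (one_le_div hδ).2 hδη
    have h2 : η / δ < p + 1 := Nat.lt_floor_add_one _
    have h3 : (1 : ℝ) ≤ p := by exact_mod_cast Nat.le_floor (by exact_mod_cast h1)
    linarith
  have hw2 : (w : ℝ) ≤ (l + 3 * η) / δ := by
    have h1 : (⌈(l + η) / δ⌉₊ : ℝ) < (l + η) / δ + 1 := Nat.ceil_lt_add_one (by positivity)
    have h2 : 1 ≤ η / δ := (one_le_div hδ).2 hδη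
    have h3 : (l + 3 * η) / δ = (l + η) / δ + 2 * (η / δ) := by ring
    rw [h3, hw]
    push_cast
    linarith
  calc η / (4 * (l + 3 * η)) * M ≤ η / (4 * (l + 3 * η)) * (2 * (M / w : ℕ) * w) := by gcongr
    _ ≤ η / (4 * (l + 3 * η)) * (2 * (M / w : ℕ) * ((l + 3 * η) / δ)) := by gcongr
    _ = (M / w : ℕ) * ((η / δ) / 2) := by field_simp; ring
    _ ≤ (M / w : ℕ) * p := by gcongr; linarith
    _ ≤ _ := by exact_mod_cast hJ.trans hmono

/-- At most `m` sample indices are wrapped around by the cyclic shift by `m`. -/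
theorem sum_indicator_wrap_le {N : ℕ} [NeZero N] (m : ZMod N) :
    ∑ j : ZMod N, (if N ≤ j.val + m.val then (1 : ℝ) else 0) ≤ m.val := by
  rw [sum_comp_val (fun n => if N ≤ n + m.val then (1 : ℝ) else 0), Finset.sum_boole]
  have h : (Finset.range N).filter (fun n => N ≤ n + m.val) ⊆ Finset.Ico (N - m.val) N := by
    intro n hn
    simp only [Finset.mem_filter, Finset.mem_range] at hn
    simp only [Finset.mem_Ico]
    omega
  have h2 := Finset.card_le_card h
  rw [Nat.card_Ico, Nat.sub_sub_self (ZMod.val_lt m).le] at h2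
  exact_mod_cast h2

/-- Autocorrelation of the samples of a bounded function at an almost period that is short compared
to the number `N` of samples: it differs little from the autocorrelation at `0`. The second error
term accounts for the samples that are wrapped around by the cyclic shift. -/
theorem norm_autocorr_sample_ge {f : ℝ → ℂ} {B ε δ : ℝ} (hδ : 0 < δ) (hε : 0 ≤ ε)
    (hB : ∀ t, 0 ≤ t → ‖f t‖ ≤ B) {N : ℕ} [NeZero N] {m : ZMod N}
    (hm : ∀ t, 0 ≤ t → ‖f (t + m.val * δ) - f t‖ ≤ ε) :
    (∑ j : ZMod N, ‖f (j.val * δ)‖ ^ 2) - (N * (ε * B) + 2 * B ^ 2 * m.val)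
      ≤ ‖autocorr (fun j : ZMod N => f (j.val * δ)) m‖ := by
  have hB0 : 0 ≤ B := (norm_nonneg _).trans (hB 0 le_rfl)
  have hfB : ∀ j : ZMod N, ‖f (j.val * δ)‖ ≤ B := fun j => hB _ (by positivity)
  have hterm : ∀ j : ZMod N, ‖(f ((j + m).val * δ) - f (j.val * δ)) * conj (f (j.val * δ))‖
      ≤ ε * B + 2 * B ^ 2 * (if N ≤ j.val + m.val then (1 : ℝ) else 0) := by
    intro j
    rw [norm_mul, RCLike.norm_conj]
    split_ifs with hw
    · have h1 : ‖f ((j + m).val * δ) - f (j.val * δ)‖ ≤ B + B :=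
        (norm_sub_le _ _).trans (add_le_add (hfB _) (hfB _))
      have h2 := mul_le_mul h1 (hfB j) (norm_nonneg _) (by positivity)
      have h3 := mul_nonneg hε hB0
      linarith
    · rw [ZMod.val_add_of_lt (not_le.1 hw), Nat.cast_add, add_mul, mul_zero, add_zero]
      exact mul_le_mul (hm _ (by positivity)) (hfB j) (norm_nonneg _) hε
  have hsum : autocorr (fun j : ZMod N => f (j.val * δ)) m
      = ((∑ j : ZMod N, ‖f (j.val * δ)‖ ^ 2 : ℝ) : ℂ)
        + ∑ j : ZMod N, (f ((j + m).val * δ) - f (j.val * δ)) * conj (f (j.val * δ)) := by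
    rw [autocorr, Complex.ofReal_sum, ← Finset.sum_add_distrib]
    refine Finset.sum_congr rfl fun j _ => ?_
    rw [sub_mul, Complex.mul_conj', Complex.ofReal_pow]
    ring
  have herr : ‖∑ j : ZMod N, (f ((j + m).val * δ) - f (j.val * δ)) * conj (f (j.val * δ))‖
      ≤ N * (ε * B) + 2 * B ^ 2 * m.val := by
    refine (norm_sum_le _ _).trans ((Finset.sum_le_sum fun j _ => hterm j).trans ?_)
    rw [Finset.sum_add_distrib, Finset.sum_const, Finset.card_univ, ZMod.card, nsmul_eq_mul,
      ← Finset.mul_sum]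
    gcongr
    exact sum_indicator_wrap_le m
  have hpos : (0 : ℝ) ≤ ∑ j : ZMod N, ‖f (j.val * δ)‖ ^ 2 := by positivity
  have h1 := norm_sub_norm_le ((∑ j : ZMod N, ‖f (j.val * δ)‖ ^ 2 : ℝ) : ℂ)
    (-∑ j : ZMod N, (f ((j + m).val * δ) - f (j.val * δ)) * conj (f (j.val * δ)))
  rw [sub_neg_eq_add, ← hsum, norm_neg, Complex.norm_real, Real.norm_of_nonneg hpos] at h1
  linarith

theorem mul_count_le_sum {S : ℕ → Prop} [DecidablePred S] {N M : ℕ} [NeZero N] (hMN : M ≤ N)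
    {g : ZMod N → ℝ} {b : ℝ} (hg : ∀ m, 0 ≤ g m) (h : ∀ m : ZMod N, m.val < M → S m.val → b ≤ g m) :
    Nat.count S M * b ≤ ∑ m, g m := by
  have h1 : ∀ m : ZMod N, (if m.val < M ∧ S m.val then b else 0) ≤ g m := by
    intro m
    split_ifs with hm
    exacts [h m hm.1 hm.2, hg m]
  refine le_trans (le_of_eq ?_) (Finset.sum_le_sum fun m _ => h1 m)
  rw [sum_comp_val (fun n => if n < M ∧ S n then b else 0), ← Finset.sum_filter, Finset.sum_const,
    nsmul_eq_mul, Nat.count_eq_card_filter_range]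
  congr 3
  ext n
  simp only [Finset.mem_filter, Finset.mem_range]
  constructor
  · rintro ⟨h1, h2⟩; exact ⟨h1.trans_le hMN, h1, h2⟩
  · rintro ⟨-, h1, h2⟩; exact ⟨h1, h2⟩

/-- Uniqueness of Fourier coefficients: an almost periodic function all of whose Fourier
coefficients vanish is zero at the origin.

Otherwise the autocorrelations of its samples on a grid are large at all short almost periods,
which have positive density, so that the fourth moment of the discrete Fourier coefficients is
large; but these coefficients are small by `AlmostPeriodic.dft_sample_le`. -/
theorem AlmostPeriodic.eq_zero_of_bohrMean {f : ℝ → ℂ} (hf : AlmostPeriodic f) (hc : Continuous f)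
    (h0 : ∀ r, HasBohrMean f r 0) : f 0 = 0 := by
  classical
  by_contra hne
  obtain ⟨B, hB, hfB⟩ := hf.exists_bound hc
  set a := ‖f 0‖ with ha
  have ha0 : 0 < a := norm_pos_iff.2 hne
  obtain ⟨c₁, hc₁, δ₁, hδ₁, H1⟩ := hf.le_count_periods hc (half_pos ha0)
  -- a lower bound for the mean of `‖f‖ ^ 2`
  set c := c₁ * (a / 2) ^ 2 with hcdef
  have hc0 : 0 < c := by positivity
  set ε := c / (4 * B) with hε
  have hε0 : 0 < ε := by positivity
  have hεB : ε * B = c / 4 := by rw [hε]; field_simp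
  obtain ⟨c₂, hc₂, δ₂, hδ₂, H2⟩ := hf.le_count_periods hc hε0
  obtain ⟨K, hK⟩ := exists_nat_ge (max 1 (8 * B ^ 2 / c))
  have hK1 : (1 : ℝ) ≤ K := (le_max_left _ _).trans hK
  have hK2 : 8 * B ^ 2 ≤ K * c := (div_le_iff₀ hc0).1 ((le_max_right _ _).trans hK)
  have hK1' : 1 ≤ K := by exact_mod_cast hK1
  have hK0 : (0 : ℝ) < K := by linarith
  set e := Real.sqrt (c₂ * c ^ 2 / (8 * K * B ^ 2)) with he
  have he0 : 0 < e := Real.sqrt_pos.2 (by positivity)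
  have he2 : e ^ 2 = c₂ * c ^ 2 / (8 * K * B ^ 2) := Real.sq_sqrt (by positivity)
  obtain ⟨δ₃, hδ₃, H3⟩ := hf.dft_sample_le hc h0 he0
  set δ := min δ₁ (min δ₂ δ₃) with hδdef
  have hδ : 0 < δ := by positivity
  obtain ⟨M₁, H1⟩ := H1 δ hδ (min_le_left _ _)
  obtain ⟨M₂, H2⟩ := H2 δ hδ ((min_le_right _ _).trans (min_le_left _ _))
  obtain ⟨N₀, H3⟩ := H3 δ hδ ((min_le_right _ _).trans (min_le_right _ _))
  -- there are `N = K * M` samples, and the autocorrelations at the shifts below `M` are estimated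
  set M := M₁ + M₂ + N₀ + 1 with hM
  set N := K * M with hN
  have hMN : M ≤ N := Nat.le_mul_of_pos_left M hK1'
  have hM0 : 0 < M := by omega
  have hN0 : 0 < N := hM0.trans_le hMN
  have : NeZero N := ⟨hN0.ne'⟩
  have hM0' : (0 : ℝ) < M := by exact_mod_cast hM0
  have hNR : (N : ℝ) = K * M := by rw [hN]; push_cast; ring
  have hN0' : (0 : ℝ) < N := by exact_mod_cast hN0
  have hlow : c * N ≤ ∑ j : ZMod N, ‖f (j.val * δ)‖ ^ 2 := by
    have h1 := H1 N (by omega)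
    have h2 := mul_count_le_sum (S := fun n : ℕ => ∀ t, 0 ≤ t → ‖f (t + n * δ) - f t‖ ≤ a / 2)
      (le_refl N) (g := fun j : ZMod N => ‖f (j.val * δ)‖ ^ 2) (b := (a / 2) ^ 2)
      (fun _ => by positivity) (fun m _ hm => by
        have h3 := hm 0 le_rfl
        rw [zero_add, norm_sub_rev] at h3
        have h4 := norm_sub_norm_le (f 0) (f (m.val * δ))
        gcongr
        linarith)
    refine le_trans ?_ h2
    rw [hcdef, mul_right_comm]
    gcongr
  have hcorr : c₂ * M * (c * N / 2) ^ 2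
      ≤ ∑ m, ‖autocorr (fun j : ZMod N => f (j.val * δ)) m‖ ^ 2 := by
    have h1 := H2 M (by omega)
    have h2 := mul_count_le_sum (S := fun n : ℕ => ∀ t, 0 ≤ t → ‖f (t + n * δ) - f t‖ ≤ ε)
      hMN (g := fun m => ‖autocorr (fun j : ZMod N => f (j.val * δ)) m‖ ^ 2)
      (b := (c * N / 2) ^ 2) (fun _ => by positivity) (fun m hmM hm => by
        have h3 := norm_autocorr_sample_ge hδ hε0.le hfB hm
        have h4 : 2 * B ^ 2 * m.val ≤ c * N / 4 := by
          have h5 : (m.val : ℝ) ≤ M := by exact_mod_cast hmM.le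
          calc 2 * B ^ 2 * m.val ≤ 2 * B ^ 2 * M := by gcongr
            _ = 8 * B ^ 2 * M / 4 := by ring
            _ ≤ K * c * M / 4 := by gcongr
            _ = c * N / 4 := by rw [hNR]; ring
        rw [hεB] at h3
        gcongr
        linarith)
    refine le_trans ?_ h2
    gcongr
  have hup := sum_norm_sq_autocorr_le _ (H3 N (by omega))
  have hup2 : ∑ j : ZMod N, ‖f (j.val * δ)‖ ^ 2 ≤ N * B ^ 2 := by
    refine (Finset.sum_le_card_nsmul _ _ (B ^ 2) fun j _ => ?_).trans (by simp [ZMod.card])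
    gcongr
    exact hfB _ (by positivity)
  have hfin := hcorr.trans (hup.trans (mul_le_mul_of_nonneg_left hup2 (by positivity)))
  have h1 : (e * N) ^ 2 * (N * B ^ 2) = c₂ * M * (c * N / 2) ^ 2 / 2 := by
    rw [mul_pow, he2, hNR]
    field_simp
    norm_num
  have h2 : 0 < c₂ * M * (c * N / 2) ^ 2 := by positivity
  linarith

end Uniqueness

/-! ### Differentiation of distributions along translations -/

section Translation

theorem mem_testFnNonneg_iff {φ : TestFn} : φ ∈ testFnNonneg ↔ ∀ x < 0, φ x = 0 := by
  refine ⟨fun h x hx => ?_, fun h => closure_minimal (fun x hx => ?_) isClosed_Ici⟩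
  · by_contra hne
    exact absurd (h (subset_tsupport _ hne)) (not_le.2 hx)
  · by_contra hlt
    exact hx (h x (not_le.1 hlt))

theorem apply_zero_of_mem_testFnNonneg {φ : TestFn} (hφ : φ ∈ testFnNonneg) : φ 0 = 0 := by
  have h1 : Tendsto φ (𝓝[<] 0) (𝓝 (φ 0)) := φ.continuous.continuousWithinAt
  have h2 : Tendsto φ (𝓝[<] 0) (𝓝 0) := by
    refine tendsto_const_nhds.congr' ?_
    filter_upwards [self_mem_nhdsWithin] with x hx
    exact (mem_testFnNonneg_iff.1 hφ x hx).symm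
  exact tendsto_nhds_unique h1 h2

theorem tderiv_mem_testFnNonneg {φ : TestFn} (hφ : φ ∈ testFnNonneg) :
    tderiv φ ∈ testFnNonneg := by
  rw [mem_testFnNonneg_iff] at hφ ⊢
  intro x hx
  rw [tderiv_apply]
  have : (φ : ℝ → ℂ) =ᶠ[𝓝 x] fun _ => 0 := by
    filter_upwards [Iio_mem_nhds hx] with y hy using hφ y hy
  rw [this.deriv_eq, deriv_const]

theorem translate_mem_testFnNonneg {φ : TestFn} (hφ : φ ∈ testFnNonneg) {t : ℝ} (ht : 0 ≤ t) :
    translate t φ ∈ testFnNonneg := by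
  rw [mem_testFnNonneg_iff] at hφ ⊢
  exact fun x hx => hφ (x - t) (by linarith)

theorem translate_apply (t : ℝ) (φ : TestFn) (s : ℝ) : translate t φ s = φ (s - t) := rfl

theorem translate_zero (φ : TestFn) : translate 0 φ = φ :=
  TestFunction.ext fun s => by rw [translate_apply, sub_zero]

theorem tderiv_translate (t : ℝ) (φ : TestFn) : tderiv (translate t φ) = translate t (tderiv φ) :=
  TestFunction.ext fun s => by
    rw [tderiv_apply, translate_apply, tderiv_apply]
    exact deriv_comp_sub_const (φ : ℝ → ℂ) t s

theorem hasDerivAt_testFn (φ : TestFn) (x : ℝ) : HasDerivAt φ (tderiv φ x) x := by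
  rw [tderiv_apply]
  exact (φ.contDiff.differentiable (by simp) x).hasDerivAt

variable {F : Type*} [NormedAddCommGroup F] [NormedSpace ℂ F]

/-- A distribution has finite order on each compact set. -/
theorem exists_order_bound (G : TestFn →L[ℂ] F) (K : Compacts ℝ) :
    ∃ C : ℝ, 0 ≤ C ∧ ∃ n : ℕ, ∀ ψ : TestFn, (∀ x ∉ K, ψ x = 0) → ∀ b : ℝ, 0 ≤ b →
      (∀ i ≤ n, ∀ x, ‖iteratedDeriv i ψ x‖ ≤ b) → ‖G ψ‖ ≤ C * b := by
  let L : ContDiffMapSupportedIn ℝ ℂ ⊤ K →L[ℂ] F :=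
    G ∘L TestFunction.ofSupportedInCLM ℂ (Ω := (⊤ : Opens ℝ)) (subset_univ _)
  obtain ⟨s, C, -, hC⟩ := Seminorm.bound_of_continuous
    (ContDiffMapSupportedIn.withSeminorms ℂ ℝ ℂ ⊤ K) ((normSeminorm ℂ F).comp (L : _ →ₗ[ℂ] F))
    (continuous_norm.comp L.continuous)
  refine ⟨C, C.2, s.sup id, fun ψ hψ b hb h => ?_⟩
  let ψK : ContDiffMapSupportedIn ℝ ℂ ⊤ K := ⟨ψ, ψ.contDiff, fun x hx => hψ x hx⟩
  have h1 : ‖L ψK‖ ≤ C * (s.sup (ContDiffMapSupportedIn.seminorm ℂ ℝ ℂ ⊤ K)) ψK := hC ψK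
  refine h1.trans (mul_le_mul_of_nonneg_left ?_ C.2)
  refine Seminorm.finset_sup_apply_le hb fun i hi => ?_
  refine (ContDiffMapSupportedIn.seminorm_top_le_iff ℂ hb i ψK).2 fun x _ => ?_
  rw [norm_iteratedFDeriv_eq_norm_iteratedDeriv]
  exact h i (Finset.le_sup (f := id) hi) x

theorem exists_bound_iteratedDeriv (φ : TestFn) (i : ℕ) :
    ∃ M : ℝ, 0 ≤ M ∧ ∀ x, ‖iteratedDeriv i φ x‖ ≤ M := by
  obtain ⟨M, hM⟩ := (φ.hasCompactSupport.iteratedFDeriv (𝕜 := ℝ) i).exists_bound_of_continuous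
    (φ.contDiff.continuous_iteratedFDeriv (by exact_mod_cast le_top))
  refine ⟨M, (norm_nonneg _).trans (hM 0), fun x => ?_⟩
  rw [← norm_iteratedFDeriv_eq_norm_iteratedDeriv]
  exact hM x

/-- Second order Taylor estimate for all derivatives of a translated function. -/
theorem norm_iteratedDeriv_taylor_le (i : ℕ) : ∀ (Φ φ : ℝ → ℂ) (M : ℝ),
    (∀ x, HasDerivAt Φ (φ x) x) → ContDiff ℝ (⊤ : ℕ∞) φ →
    (∀ x, ‖iteratedDeriv (i + 1) φ x‖ ≤ M) → ∀ a b x : ℝ,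
      ‖iteratedDeriv i (fun s => Φ (s - a) - Φ (s - b) + (a - b) * φ (s - b)) x‖
        ≤ M * (a - b) ^ 2 := by
  induction i with
  | zero =>
    intro Φ φ M hΦ hφ hM a b x
    simp only [zero_add, iteratedDeriv_one] at hM
    rw [iteratedDeriv_zero]
    have hd : Differentiable ℝ φ := hφ.differentiable (by simp)
    have hM0 : 0 ≤ M := (norm_nonneg _).trans (hM 0)
    have hlip : ∀ y z, ‖φ y - φ z‖ ≤ M * |y - z| := fun y z =>
      convex_univ.norm_image_sub_le_of_norm_deriv_le (fun w _ => hd w) (fun w _ => hM w)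
        (mem_univ z) (mem_univ y)
    have h := (convex_uIcc b a).norm_image_sub_le_of_norm_hasDerivWithin_le
      (f := fun t : ℝ => Φ (x - t) + t * φ (x - b)) (f' := fun t => -φ (x - t) + φ (x - b))
      (C := M * |a - b|) (x := b) (y := a) (fun t _ => ?_) (fun t ht => ?_)
      left_mem_uIcc right_mem_uIcc
    · have e : Φ (x - a) - Φ (x - b) + (a - b) * φ (x - b)
          = (Φ (x - a) + a * φ (x - b)) - (Φ (x - b) + b * φ (x - b)) := by ring
      rw [e]
      refine h.trans (le_of_eq ?_)
      rw [Real.norm_eq_abs, mul_assoc, abs_mul_abs_self, sq]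
    · have h1 : HasDerivAt (fun t : ℝ => Φ (x - t)) (-φ (x - t)) t :=
        (hΦ (x - t)).comp_const_sub x t
      have h2 : HasDerivAt (fun t : ℝ => (t : ℂ) * φ (x - b)) (φ (x - b)) t := by
        simpa using (hasDerivAt_id t).ofReal_comp.mul_const (φ (x - b))
      exact (h1.add h2).hasDerivWithinAt
    · rw [neg_add_eq_sub]
      refine (hlip _ _).trans ?_
      rw [sub_sub_sub_cancel_left]
      gcongr 1
      exact abs_sub_left_of_mem_uIcc ht
  | succ i ih =>
    intro Φ φ M hΦ hφ hM a b x
    have hd : ∀ x, HasDerivAt φ (deriv φ x) x := fun x =>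
      (hφ.differentiable (by simp) x).hasDerivAt
    have hφ' : ContDiff ℝ (⊤ : ℕ∞) (deriv φ) := (contDiff_infty_iff_deriv.1 hφ).2
    rw [iteratedDeriv_succ']
    have e : deriv (fun s => Φ (s - a) - Φ (s - b) + (a - b) * φ (s - b))
        = fun s => φ (s - a) - φ (s - b) + (a - b) * deriv φ (s - b) := by
      funext s
      exact ((((hΦ (s - a)).comp_sub_const s a).sub ((hΦ (s - b)).comp_sub_const s b)).add
        (((hd (s - b)).comp_sub_const s b).const_mul ((a : ℂ) - b))).deriv
    rw [e]
    refine ih φ (deriv φ) M hd hφ' (fun x => ?_) a b x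
    rw [← iteratedDeriv_succ']
    exact hM x

/-- Let `ψ a` be test functions of the form `s ↦ Φ (s - a) + c s`, where the derivative of `Φ` is a
test function `φ`. Then `G (ψ a)` is differentiable in `a`, with derivative `-G (δ_a * φ)`. -/
theorem hasDerivAt_translation (G : TestFn →L[ℂ] F) {Φ : ℝ → ℂ} {φ : TestFn}
    (hΦ : ∀ x, HasDerivAt Φ (φ x) x) {ψ : ℝ → TestFn}
    (hψ : ∀ a b s, ψ a s - ψ b s = Φ (s - a) - Φ (s - b)) (b : ℝ) :
    HasDerivAt (fun a => G (ψ a)) (-G (translate b φ)) b := by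
  obtain ⟨R, hR, hφR⟩ := exists_bound_support φ
  let K : Compacts ℝ := ⟨Metric.closedBall b (R + 1), isCompact_closedBall _ _⟩
  obtain ⟨C, hC, n, hG⟩ := exists_order_bound G K
  choose M hM0 hM using fun i => exists_bound_iteratedDeriv φ (i + 1)
  set M' := ∑ i ∈ Finset.range (n + 1), M i with hM'
  have hM'0 : 0 ≤ M' := Finset.sum_nonneg fun i _ => hM0 i
  have key : ∀ a, |a - b| ≤ 1 →
      ‖G (ψ a - ψ b + (a - b : ℂ) • translate b φ)‖ ≤ C * (M' * (a - b) ^ 2) := by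
    intro a ha
    have happ : ∀ s, (ψ a - ψ b + (a - b : ℂ) • translate b φ : TestFn) s
        = Φ (s - a) - Φ (s - b) + (a - b) * φ (s - b) := fun s => by
      rw [← hψ]; rfl
    refine hG _ (fun x hx => ?_) _ (by positivity) fun i hi x => ?_
    · have hx' : R + 1 < |x - b| := by
        rw [← Real.dist_eq]
        exact not_le.1 hx
      have hz : ∀ t ∈ uIcc b a, φ (x - t) = 0 := by
        intro t ht
        refine hφR _ ?_
        have h1 := abs_sub_left_of_mem_uIcc ht
        have h2 := abs_sub_abs_le_abs_sub (x - b) (t - b)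
        rw [sub_sub_sub_cancel_right] at h2
        linarith
      have h0 : Φ (x - a) - Φ (x - b) = 0 := by
        rw [← norm_le_zero_iff]
        have := (convex_uIcc b a).norm_image_sub_le_of_norm_hasDerivWithin_le
          (f := fun t : ℝ => Φ (x - t)) (f' := fun t => -φ (x - t))
          (C := 0) (x := b) (y := a) (fun t _ => by
            have h1 : HasDerivAt (fun t : ℝ => Φ (x - t)) (-φ (x - t)) t :=
              (hΦ (x - t)).comp_const_sub x t
            exact h1.hasDerivWithinAt) (fun t ht => by simp [hz t ht])
          left_mem_uIcc right_mem_uIcc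
        simpa using this
      rw [happ, h0, hφR _ (by linarith), mul_zero, add_zero]
    · have h1 := norm_iteratedDeriv_taylor_le i Φ φ (M i) hΦ φ.contDiff (hM i) a b x
      rw [show ((ψ a - ψ b + (a - b : ℂ) • translate b φ : TestFn) : ℝ → ℂ)
        = fun s => Φ (s - a) - Φ (s - b) + (a - b) * φ (s - b) from funext happ]
      refine h1.trans ?_
      gcongr
      exact Finset.single_le_sum (fun j _ => hM0 j) (Finset.mem_range.2 (Nat.lt_succ_of_le hi))
  rw [hasDerivAt_iff_isLittleO]
  refine Asymptotics.IsBigO.trans_isLittleO ?_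
    (Asymptotics.isLittleO_pow_sub_sub b (m := 2) one_lt_two)
  refine Asymptotics.IsBigO.of_bound (C * M') ?_
  filter_upwards [Metric.closedBall_mem_nhds b one_pos] with a ha
  rw [Metric.mem_closedBall, Real.dist_eq] at ha
  have h1 := key a ha
  rw [map_add, map_sub, map_smul] at h1
  have e : G (ψ a) - G (ψ b) - (a - b) • -G (translate b φ)
      = G (ψ a) - G (ψ b) + (a - b : ℂ) • G (translate b φ) := by
    rw [smul_neg, sub_neg_eq_add, ← Complex.coe_smul]
    push_cast
    rfl
  rw [e, Real.norm_eq_abs, Real.norm_eq_abs, sq_abs, abs_of_nonneg (sq_nonneg _), mul_assoc]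
  exact h1

theorem hasDerivAt_apply_translate (G : TestFn →L[ℂ] F) (φ : TestFn) (b : ℝ) :
    HasDerivAt (fun a => G (translate a φ)) (-G (translate b (tderiv φ))) b :=
  hasDerivAt_translation G (hasDerivAt_testFn φ) (fun _ _ _ => rfl) b

theorem integrable_testFn (φ : TestFn) : Integrable (φ : ℝ → ℂ) :=
  φ.continuous.integrable_of_hasCompactSupport φ.hasCompactSupport

theorem hasDerivAt_integral_Iic (φ : TestFn) (x : ℝ) :
    HasDerivAt (fun x => ∫ t in Iic x, φ t) (φ x) x := by
  have h : (fun x => ∫ t in Iic x, φ t) =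
      fun x => (∫ t in Iic (0 : ℝ), φ t) + ∫ t in (0 : ℝ)..x, φ t := by
    funext x
    rw [← intervalIntegral.integral_Iic_sub_Iic (integrable_testFn φ).integrableOn
      (integrable_testFn φ).integrableOn]
    ring
  rw [h]
  exact (intervalIntegral.integral_hasDerivAt_right (φ.continuous.intervalIntegrable _ _)
    (φ.continuous.stronglyMeasurableAtFilter _ _) φ.continuous.continuousAt).const_add _

theorem antideriv_apply (N : Normalizer) (φ : TestFn) (x : ℝ) :
    antideriv N φ x = (∫ t in Iic x, φ t) - (∫ t in Iic x, N.ζ t) * ∫ u, φ u := by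
  change ∫ t in Iic x, (φ t - N.ζ t * ∫ u, φ u) = _
  rw [integral_sub (integrable_testFn φ).integrableOn
    ((integrable_testFn N.ζ).integrableOn.mul_const _), integral_mul_const]

theorem integral_Iic_tderiv (φ : TestFn) (x : ℝ) : ∫ t in Iic x, tderiv φ t = φ x := by
  have h0 : Tendsto (φ : ℝ → ℂ) atBot (𝓝 0) := by
    obtain ⟨R, -, hφR⟩ := exists_bound_support φ
    refine tendsto_const_nhds.congr' ?_
    filter_upwards [eventually_lt_atBot (-R), eventually_lt_atBot 0] with y hy hy0
    exact (hφR y (by rw [abs_of_neg hy0]; linarith)).symm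
  rw [integral_Iic_of_hasDerivAt_of_tendsto' (fun y _ => hasDerivAt_testFn φ y)
    (integrable_testFn _).integrableOn h0, sub_zero]

theorem antideriv_tderiv (N : Normalizer) (φ : TestFn) : antideriv N (tderiv φ) = φ := by
  have h : ∫ u, tderiv φ u = 0 := by
    obtain ⟨R, hR, hφR⟩ := exists_bound_support φ
    have := integral_of_hasDerivAt_of_tendsto (f := φ) (m := 0) (n := 0)
      (fun y => hasDerivAt_testFn φ y) (integrable_testFn _) ?_ ?_
    · rw [this, sub_zero]
    · refine tendsto_const_nhds.congr' ?_
      filter_upwards [eventually_lt_atBot (-R), eventually_lt_atBot 0] with y hy hy0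
      exact (hφR y (by rw [abs_of_neg hy0]; linarith)).symm
    · refine tendsto_const_nhds.congr' ?_
      filter_upwards [eventually_gt_atTop R] with y hy
      exact (hφR y (hy.trans_le (le_abs_self y))).symm
  exact TestFunction.ext fun x => by
    rw [antideriv_apply, h, mul_zero, sub_zero, integral_Iic_tderiv]

theorem antideriv_translate_apply (N : Normalizer) (φ : TestFn) (a x : ℝ) :
    antideriv N (translate a φ) x
      = (∫ t in Iic (x - a), φ t) - (∫ t in Iic x, N.ζ t) * ∫ u, φ u := by
  rw [antideriv_apply]
  have h1 : ∫ u, translate a φ u = ∫ u, φ u := integral_sub_right_eq_self (fun t => φ t) a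
  have h2 : ∫ t in Iic x, translate a φ t = ∫ t in Iic (x - a), φ t := by
    rw [← (measurePreserving_sub_right volume a).setIntegral_preimage_emb
      (MeasurableEquiv.subRight a).measurableEmbedding (fun t => φ t) (Iic (x - a))]
    have h3 : (fun t : ℝ => t - a) ⁻¹' Iic (x - a) = Iic x := by
      ext t
      simp
    rw [h3]
    rfl
  rw [h1, h2]

variable {X : Type*} [NormedAddCommGroup X] [NormedSpace ℂ X]

theorem primitive_tderiv (N : Normalizer) (G : OpDist X) (φ : TestFn) :
    primitive N G (tderiv φ) = -G φ := by
  rw [primitive, antideriv_tderiv]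

theorem hasDerivAt_primitive_translate (N : Normalizer) (G : OpDist X) (φ : TestFn) (b : ℝ) :
    HasDerivAt (fun a => primitive N G (translate a φ))
      (-primitive N G (translate b (tderiv φ))) b := by
  have h := (hasDerivAt_translation G (hasDerivAt_integral_Iic φ)
    (ψ := fun a => antideriv N (translate a φ)) (fun a b s => by
      rw [antideriv_translate_apply, antideriv_translate_apply]; ring) b).neg
  rw [← tderiv_translate, primitive_tderiv]
  exact h

end Translation

/-! ### Bohr means of solutions -/

section Means

variable {X : Type*} [NormedAddCommGroup X] [NormedSpace ℂ X]

theorem hasBohrMean_iff {f : ℝ → X} {r : ℝ} {p : X} :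
    HasBohrMean f r p ↔
      Tendsto (fun t : ℝ => t⁻¹ • ∫ s in (0 : ℝ)..t, bohrChar r s • f s) atTop (𝓝 p) :=
  Iff.rfl

/-- The Bohr mean only depends on the values on the half-line. -/
theorem HasBohrMean.congr {f g : ℝ → X} {r : ℝ} {p : X} (hf : HasBohrMean f r p)
    (h : ∀ t, 0 ≤ t → f t = g t) : HasBohrMean g r p := by
  rw [hasBohrMean_iff] at hf ⊢
  refine hf.congr' ?_
  filter_upwards [eventually_ge_atTop 0] with t ht
  congr 1
  refine intervalIntegral.integral_congr fun s hs => ?_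
  rw [uIcc_of_le ht] at hs
  simp only [h s hs.1]

theorem HasBohrMean.map {Y : Type*} [NormedAddCommGroup Y] [NormedSpace ℂ Y] [CompleteSpace X]
    [CompleteSpace Y] {f : ℝ → X} {r : ℝ} {p : X} (hf : HasBohrMean f r p) (hc : Continuous f)
    (L : X →L[ℂ] Y) : HasBohrMean (fun t => L (f t)) r (L p) := by
  rw [hasBohrMean_iff] at hf ⊢
  refine ((L.continuous.tendsto p).comp hf).congr fun t => ?_
  have h : ∫ s in (0 : ℝ)..t, L (bohrChar r s • f s) = L (∫ s in (0 : ℝ)..t, bohrChar r s • f s) :=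
    L.intervalIntegral_comp_comm (Continuous.intervalIntegrable (by fun_prop) _ _)
  simp only [map_smul] at h
  rw [Function.comp_apply, L.map_smul_of_tower, h]

theorem AlmostPeriodic.congr {X : Type*} [NormedAddCommGroup X] {f g : ℝ → X}
    (hf : AlmostPeriodic f) (h : ∀ t, 0 ≤ t → f t = g t) : AlmostPeriodic g := by
  intro ε hε
  obtain ⟨l, hl, H⟩ := hf ε hε
  refine ⟨l, hl, fun a ha => ?_⟩
  obtain ⟨τ, hτ, H⟩ := H a ha
  refine ⟨τ, hτ, fun t ht => ?_⟩
  rw [← h t ht, ← h (t + τ) (add_nonneg ht (ha.trans hτ.1))]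
  exact H t ht

theorem AlmostPeriodic.map {Y : Type*} [NormedAddCommGroup Y] [NormedSpace ℂ Y] {f : ℝ → X}
    (hf : AlmostPeriodic f) (L : X →L[ℂ] Y) : AlmostPeriodic fun t => L (f t) := by
  intro ε hε
  obtain ⟨l, hl, H⟩ := hf (ε / (‖L‖ + 1)) (by positivity)
  refine ⟨l, hl, fun a ha => ?_⟩
  obtain ⟨τ, hτ, H⟩ := H a ha
  refine ⟨τ, hτ, fun t ht => ?_⟩
  rw [← map_sub]
  calc ‖L (f (t + τ) - f t)‖ ≤ ‖L‖ * (ε / (‖L‖ + 1)) := L.le_opNorm_of_le (H t ht)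
    _ ≤ (‖L‖ + 1) * (ε / (‖L‖ + 1)) := by gcongr; linarith
    _ = ε := by field_simp

/-- A function with bounded second derivative, which is itself bounded, has a bounded derivative. -/
theorem norm_deriv_le_of_bounded {m m' m'' : ℝ → X} (hd : ∀ t, HasDerivAt m (m' t) t)
    (hd' : ∀ t, HasDerivAt m' (m'' t) t) {M M₂ : ℝ} (hM : ∀ t, 0 ≤ t → ‖m t‖ ≤ M)
    (hM₂ : ∀ t, 0 ≤ t → ‖m'' t‖ ≤ M₂) {t : ℝ} (ht : 0 ≤ t) : ‖m' t‖ ≤ 2 * M + M₂ := by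
  have hM₂0 : 0 ≤ M₂ := (norm_nonneg _).trans (hM₂ 0 le_rfl)
  have h1 : ∀ s ∈ Icc t (t + 1), ‖m' s - m' t‖ ≤ M₂ := by
    intro s hs
    have := (convex_Icc t (t + 1)).norm_image_sub_le_of_norm_hasDerivWithin_le
      (fun x _ => (hd' x).hasDerivWithinAt) (fun x hx => hM₂ x (ht.trans hx.1))
      (left_mem_Icc.2 (by linarith)) hs
    refine this.trans (mul_le_of_le_one_right hM₂0 ?_)
    rw [Real.norm_of_nonneg (by linarith [hs.1])]
    linarith [hs.2]
  have h2 := (convex_Icc t (t + 1)).norm_image_sub_le_of_norm_hasDerivWithin_le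
    (f := fun s => m s - s • m' t) (f' := fun s => m' s - m' t) (C := M₂)
    (x := t) (y := t + 1)
    (fun x _ => by
      have h3 := (hd x).sub ((hasDerivAt_id x).smul_const (m' t))
      rw [one_smul] at h3
      exact h3.hasDerivWithinAt) h1
    (left_mem_Icc.2 (by linarith)) (right_mem_Icc.2 (by linarith))
  rw [add_sub_cancel_left, norm_one, mul_one, add_smul, one_smul] at h2
  have e : m' t = m (t + 1) - m t - (m (t + 1) - (t • m' t + m' t) - (m t - t • m' t)) := by abel
  rw [e]
  refine (norm_sub_le _ _).trans (add_le_add ((norm_sub_le _ _).trans ?_) h2)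
  linarith [hM t ht, hM (t + 1) (by linarith)]

variable [CompleteSpace X]

theorem AlmostPeriodic.exists_hasBohrMean {f : ℝ → X} (hf : AlmostPeriodic f) (hc : Continuous f)
    (r : ℝ) : ∃ p, HasBohrMean f r p :=
  (hf.bohrChar_smul hc r).exists_mean (by fun_prop)

/-- The Bohr mean of the derivative of a bounded function, by integration by parts. -/
theorem HasBohrMean.deriv {m m' : ℝ → X} {r : ℝ} {q : X} (hm : HasBohrMean m r q)
    (hd : ∀ t, HasDerivAt m (m' t) t) (hc : Continuous m') {M : ℝ}
    (hM : ∀ t, 0 ≤ t → ‖m t‖ ≤ M) : HasBohrMean m' r ((Complex.I * r) • q) := by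
  have hmc : Continuous m := continuous_iff_continuousAt.2 fun t => (hd t).continuousAt
  have hibp : ∀ t, ∫ s in (0 : ℝ)..t, bohrChar r s • m' s
      = (bohrChar r t • m t - m 0) + (Complex.I * r) • ∫ s in (0 : ℝ)..t, bohrChar r s • m s := by
    intro t
    have h1 := intervalIntegral.integral_eq_sub_of_hasDerivAt (a := 0) (b := t)
      (fun s _ => (hasDerivAt_bohrChar r s).smul (hd s))
      (Continuous.intervalIntegrable (by fun_prop) _ _)
    rw [intervalIntegral.integral_add (Continuous.intervalIntegrable (by fun_prop) _ _)
      (Continuous.intervalIntegrable (by fun_prop) _ _), Pi.smul_apply', Pi.smul_apply',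
      bohrChar_zero, one_smul] at h1
    simp_rw [mul_smul (-(Complex.I * r))] at h1
    rw [intervalIntegral.integral_smul, neg_smul] at h1
    rw [← h1]
    abel
  rw [hasBohrMean_iff] at hm ⊢
  have h0 : Tendsto (fun t : ℝ => t⁻¹ • (bohrChar r t • m t - m 0)) atTop (𝓝 0) := by
    refine squeeze_zero_norm' (a := fun t : ℝ => t⁻¹ * (M + M)) ?_ ?_
    · filter_upwards [eventually_gt_atTop 0] with t ht
      rw [norm_smul, norm_inv, Real.norm_of_nonneg ht.le]
      gcongr
      refine (norm_sub_le _ _).trans (add_le_add ?_ (hM 0 le_rfl))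
      rw [norm_smul, norm_bohrChar, one_mul]
      exact hM t ht.le
    · simpa using tendsto_inv_atTop_zero.mul_const (M + M)
  have h1 := h0.add (hm.const_smul (Complex.I * r))
  rw [zero_add] at h1
  refine h1.congr fun t => ?_
  rw [hibp, smul_add, smul_comm (Complex.I * r)]

theorem hasDerivAt_integral {u : ℝ → X} (hu : Continuous u) (t : ℝ) :
    HasDerivAt (fun t => ∫ s in (0 : ℝ)..t, u s) (u t) t :=
  intervalIntegral.integral_hasDerivAt_right (hu.intervalIntegrable _ _)
    (hu.stronglyMeasurableAtFilter _ _) hu.continuousAt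

theorem continuous_integral {u : ℝ → X} (hu : Continuous u) :
    Continuous fun t => ∫ s in (0 : ℝ)..t, u s :=
  continuous_iff_continuousAt.2 fun t => (hasDerivAt_integral hu t).continuousAt

theorem hasDerivAt_integral_sub_smul {u : ℝ → X} (hu : Continuous u) (t : ℝ) :
    HasDerivAt (fun t => ∫ s in (0 : ℝ)..t, (t - s) • u s) (∫ s in (0 : ℝ)..t, u s) t := by
  have e : (fun t : ℝ => ∫ s in (0 : ℝ)..t, (t - s) • u s)
      = fun t => (t • ∫ s in (0 : ℝ)..t, u s) - ∫ s in (0 : ℝ)..t, s • u s := by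
    funext t
    rw [← intervalIntegral.integral_smul, ← intervalIntegral.integral_sub
      (Continuous.intervalIntegrable (by fun_prop) _ _)
      (Continuous.intervalIntegrable (by fun_prop) _ _)]
    simp_rw [sub_smul]
  rw [e]
  have h1 := ((hasDerivAt_id t).smul (hasDerivAt_integral hu t)).sub
    (hasDerivAt_integral (u := fun s => s • u s) (by fun_prop) t)
  refine h1.congr_deriv ?_
  rw [one_smul, id, add_sub_cancel_left]

/-- A mild solution `u` of `u' = A u`: the Bohr mean `p` satisfies `A p = ir p`, tested against a
pair of operators `B₁`, `B₂` with `B₁ = B₂ A`. -/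
theorem bohrMean_eigen_first_order {u : ℝ → X} (hu : Continuous u) {M : ℝ}
    (hM : ∀ t, 0 ≤ t → ‖u t‖ ≤ M) {x : X} {B₁ B₂ : X →L[ℂ] X}
    (h : ∀ t, 0 ≤ t → B₁ (∫ s in (0 : ℝ)..t, u s) = B₂ (u t - x)) {r : ℝ} {p : X}
    (hp : HasBohrMean u r p) : B₁ p = B₂ ((Complex.I * r) • p) := by
  set m : ℝ → X := fun t => B₂ x + B₁ (∫ s in (0 : ℝ)..t, u s) with hm
  have hmu : ∀ t, 0 ≤ t → B₂ (u t) = m t := fun t ht => by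
    rw [hm]
    simp only [h t ht, map_sub]
    abel
  have hd : ∀ t, HasDerivAt m (B₁ (u t)) t := fun t =>
    ((B₁.restrictScalars ℝ).hasFDerivAt.comp_hasDerivAt t (hasDerivAt_integral hu t)).const_add _
  have h1 := ((hp.map hu B₂).congr hmu).deriv hd (by fun_prop) (M := ‖B₂‖ * M)
    fun t ht => by rw [← hmu t ht]; exact B₂.le_opNorm_of_le (hM t ht)
  rw [map_smul]
  exact tendsto_nhds_unique (hp.map hu B₁) h1

/-- A mild solution `u` of `u'' = A u`: the Bohr mean `p` satisfies `A p = -r² p`, tested against a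
pair of operators `B₁`, `B₂` with `B₁ = B₂ A`. -/
theorem bohrMean_eigen_second_order {u : ℝ → X} (hu : Continuous u) {M : ℝ}
    (hM : ∀ t, 0 ≤ t → ‖u t‖ ≤ M) {x : X} {B₁ B₂ : X →L[ℂ] X}
    (h : ∀ t, 0 ≤ t → B₁ (∫ s in (0 : ℝ)..t, (t - s) • u s) = B₂ (u t - x)) {r : ℝ} {p : X}
    (hp : HasBohrMean u r p) : B₁ p = B₂ ((-(r : ℂ) ^ 2) • p) := by
  set m : ℝ → X := fun t => B₂ x + B₁ (∫ s in (0 : ℝ)..t, (t - s) • u s) with hm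
  have hmu : ∀ t, 0 ≤ t → B₂ (u t) = m t := fun t ht => by
    rw [hm]
    simp only [h t ht, map_sub]
    abel
  have hv := continuous_integral hu
  have hd : ∀ t, HasDerivAt m (B₁ (∫ s in (0 : ℝ)..t, u s)) t := fun t =>
    ((B₁.restrictScalars ℝ).hasFDerivAt.comp_hasDerivAt t
      (hasDerivAt_integral_sub_smul hu t)).const_add _
  have hd' : ∀ t, HasDerivAt (fun t => B₁ (∫ s in (0 : ℝ)..t, u s)) (B₁ (u t)) t := fun t =>
    (B₁.restrictScalars ℝ).hasFDerivAt.comp_hasDerivAt t (hasDerivAt_integral hu t)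
  have hmM : ∀ t, 0 ≤ t → ‖m t‖ ≤ ‖B₂‖ * M := fun t ht => by
    rw [← hmu t ht]; exact B₂.le_opNorm_of_le (hM t ht)
  have h1 := ((hp.map hu B₂).congr hmu).deriv hd (by fun_prop) hmM
  have h2 := h1.deriv hd' (by fun_prop) (M := 2 * (‖B₂‖ * M) + ‖B₁‖ * M) fun t ht =>
    norm_deriv_le_of_bounded hd hd' hmM (fun t ht => B₁.le_opNorm_of_le (hM t ht)) ht
  have h3 : (-(r : ℂ) ^ 2) = (Complex.I * r) * (Complex.I * r) := by
    rw [mul_mul_mul_comm, Complex.I_mul_I]; ring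
  rw [map_smul, h3, mul_smul]
  exact tendsto_nhds_unique (hp.map hu B₁) h2

/-- If the Bohr means of almost periodic functions lie in a closed subspace, then so do their
initial values. -/
theorem mem_of_bohrMean_mem {W : Submodule ℂ X} (hW : IsClosed (W : Set X)) {u : ℝ → X}
    (hu : AlmostPeriodic u) (hc : Continuous u) (h : ∀ r, ∃ p ∈ W, HasBohrMean u r p) :
    u 0 ∈ W := by
  have : IsClosed (W : Set X) := hW
  rw [← Submodule.Quotient.mk_eq_zero]
  refine SeparatingDual.eq_zero_of_forall_dual_eq_zero (R := ℂ) fun g => ?_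
  have hL : ∀ y, (g ∘L W.mkQL) y = g (Submodule.Quotient.mk y) := fun y => rfl
  rw [← hL]
  refine (hu.map (g ∘L W.mkQL)).eq_zero_of_bohrMean (by fun_prop) fun r => ?_
  obtain ⟨p, hpW, hp⟩ := h r
  have h1 := hp.map hc (g ∘L W.mkQL)
  rwa [hL, (Submodule.Quotient.mk_eq_zero W).2 hpW, map_zero] at h1

end Means

/-! ### Solutions as orbits of the distribution -/

section Orbits

variable {X : Type*} [NormedAddCommGroup X] [NormedSpace ℂ X]

theorem hasDerivAt_clm_apply {F : ℝ → X →L[ℂ] X} {F' : X →L[ℂ] X} {v : ℝ → X} {v' : X} {s : ℝ}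
    (hF : HasDerivAt F F' s) (hv : HasDerivAt v v' s) :
    HasDerivAt (fun s => F s (v s)) (F' (v s) + F s v') s :=
  HasDerivAt.clm_apply (𝕜 := ℝ)
    (((ContinuousLinearMap.restrictScalarsL ℂ X X ℝ ℝ).hasFDerivAt.comp_hasDerivAt s hF)) hv

theorem exists_continuous_extension {Y : Type*} [TopologicalSpace Y] {u : ℝ → Y}
    (hu : ContinuousOn u (Ici 0)) : ∃ w : ℝ → Y, Continuous w ∧ ∀ t, 0 ≤ t → w t = u t :=
  ⟨fun t => u (max t 0), hu.comp_continuous (by fun_prop) fun t => mem_Ici.2 (le_max_right t 0),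
    fun t ht => by simp only [max_eq_left ht]⟩

theorem exists_continuous_of_mem_solutionSpace {A : X →ₗ.[ℂ] X} {x : X}
    (hx : x ∈ solutionSpace A) : ∃ u : ℝ → X, Continuous u ∧ u 0 = x ∧
      ∀ t : ℝ, 0 ≤ t → ((∫ s in (0 : ℝ)..t, u s), u t - x) ∈ A.graph := by
  obtain ⟨u, hu, h⟩ := hx
  obtain ⟨w, hw, hwu⟩ := exists_continuous_extension hu
  have h' : ∀ t : ℝ, 0 ≤ t → ((∫ s in (0 : ℝ)..t, w s), w t - x) ∈ A.graph := by
    intro t ht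
    have e : ∫ s in (0 : ℝ)..t, w s = ∫ s in (0 : ℝ)..t, u s :=
      intervalIntegral.integral_congr fun s hs => hwu s (uIcc_of_le ht ▸ hs).1
    rw [e, hwu t ht]
    exact h t ht
  refine ⟨w, hw, ?_, h'⟩
  exact sub_eq_zero.1 (A.graph_fst_eq_zero_snd (h' 0 le_rfl) (by simp))

theorem exists_continuous_of_mem_solutionSpace₂ {A : X →ₗ.[ℂ] X} {x : X}
    (hx : x ∈ solutionSpace₂ A) : ∃ u : ℝ → X, Continuous u ∧ u 0 = x ∧
      ∀ t : ℝ, 0 ≤ t → ((∫ s in (0 : ℝ)..t, (t - s) • u s), u t - x) ∈ A.graph := by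
  obtain ⟨u, hu, h⟩ := hx
  obtain ⟨w, hw, hwu⟩ := exists_continuous_extension hu
  have h' : ∀ t : ℝ, 0 ≤ t → ((∫ s in (0 : ℝ)..t, (t - s) • w s), w t - x) ∈ A.graph := by
    intro t ht
    have e : ∫ s in (0 : ℝ)..t, (t - s) • w s = ∫ s in (0 : ℝ)..t, (t - s) • u s :=
      intervalIntegral.integral_congr fun s hs => by
        simp only [hwu s (uIcc_of_le ht ▸ hs).1]
    rw [e, hwu t ht]
    exact h t ht
  refine ⟨w, hw, ?_, h'⟩
  exact sub_eq_zero.1 (A.graph_fst_eq_zero_snd (h' 0 le_rfl) (by simp))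

theorem hasDerivAt_translate_sub {Q : TestFn → X →L[ℂ] X}
    (hQ : ∀ φ b, HasDerivAt (fun a => Q (translate a φ)) (-Q (translate b (tderiv φ))) b)
    (φ : TestFn) (t s : ℝ) :
    HasDerivAt (fun s => Q (translate (t - s) φ)) (Q (translate (t - s) (tderiv φ))) s := by
  have h := (hQ φ (t - s)).comp_const_sub t s
  rwa [neg_neg] at h

theorem continuous_apply_translate {Q : TestFn → X →L[ℂ] X}
    (hQ : ∀ φ b, HasDerivAt (fun a => Q (translate a φ)) (-Q (translate b (tderiv φ))) b)
    (φ : TestFn) (x : X) :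
    Continuous fun a => Q (translate a φ) x := by
  have : Continuous fun a => Q (translate a φ) :=
    continuous_iff_continuousAt.2 fun a => (hQ φ a).continuousAt
  exact this.clm_apply continuous_const

variable [CompleteSpace X]

/-- If `L t = ∫₀ᵗ f (t - s) ds` for `t ≥ 0`, where the primitives of the integrands are given
explicitly, then the derivative of `L` is `f`. -/
theorem eq_of_hasDerivAt_primitive {f L ℓ : ℝ → X} (hf : Continuous f)
    (hL : ∀ t, 0 ≤ t → HasDerivAt L (ℓ t) t)
    (h : ∀ t, 0 ≤ t → ∃ k : ℝ → X, k 0 = 0 ∧ k t = L t ∧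
      ∀ s ∈ Icc 0 t, HasDerivAt k (f (t - s)) s) {t : ℝ} (ht : 0 ≤ t) : ℓ t = f t := by
  have key : ∀ t, 0 ≤ t → L t = ∫ s in (0 : ℝ)..t, f s := by
    intro t ht
    obtain ⟨k, hk0, hkt, hk⟩ := h t ht
    have h1 := intervalIntegral.integral_eq_sub_of_hasDerivAt (a := 0) (b := t) (f := k)
      (fun s hs => hk s (uIcc_of_le ht ▸ hs))
      (Continuous.intervalIntegrable (by fun_prop) _ _)
    rw [hk0, hkt, sub_zero, intervalIntegral.integral_comp_sub_left, sub_self, sub_zero] at h1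
    exact h1.symm
  have h1 : HasDerivWithinAt L (f t) (Ici t) t :=
    (hasDerivAt_integral hf t).hasDerivWithinAt.congr (fun s hs => key s (ht.trans hs)) (key t ht)
  exact (uniqueDiffWithinAt_Ici t).eq_deriv _ (hL t ht).hasDerivWithinAt h1

/-- A mild solution of the first order problem is the orbit of its initial value. -/
theorem orbit_first_order {Q : TestFn → X →L[ℂ] X}
    (hQ : ∀ φ b, HasDerivAt (fun a => Q (translate a φ)) (-Q (translate b (tderiv φ))) b)
    {u : ℝ → X} (hu : Continuous u) {x : X}
    (h : ∀ t, 0 ≤ t → ∀ φ ∈ testFnNonneg,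
      -Q (tderiv φ) (∫ s in (0 : ℝ)..t, u s) = Q φ (u t - x))
    {t : ℝ} (ht : 0 ≤ t) {φ : TestFn} (hφ : φ ∈ testFnNonneg) :
    Q (translate t φ) x = Q φ (u t) := by
  refine (eq_of_hasDerivAt_primitive (f := fun a => Q (translate a φ) x)
    (L := fun t => Q φ (∫ s in (0 : ℝ)..t, u s)) (ℓ := fun t => Q φ (u t))
    (continuous_apply_translate hQ φ x)
    (fun t _ => ((Q φ).restrictScalars ℝ).hasFDerivAt.comp_hasDerivAt t
      (hasDerivAt_integral hu t)) (fun t ht => ?_) ht).symm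
  refine ⟨fun s => Q (translate (t - s) φ) (∫ σ in (0 : ℝ)..s, u σ), by simp,
    by simp only [sub_self, translate_zero], fun s hs => ?_⟩
  refine (hasDerivAt_clm_apply (hasDerivAt_translate_sub hQ φ t s)
    (hasDerivAt_integral hu s)).congr_deriv ?_
  have h1 := h s hs.1 _ (translate_mem_testFnNonneg hφ (sub_nonneg.2 hs.2))
  rw [tderiv_translate, map_sub, neg_eq_iff_eq_neg] at h1
  rw [h1]
  abel

/-- A mild solution of the second order problem, together with its primitive, is the orbit of its
initial value. -/
theorem orbit_second_order {Q : TestFn → X →L[ℂ] X}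
    (hQ : ∀ φ b, HasDerivAt (fun a => Q (translate a φ)) (-Q (translate b (tderiv φ))) b)
    {u : ℝ → X} (hu : Continuous u) {x : X}
    (h : ∀ t, 0 ≤ t → ∀ φ ∈ testFnNonneg,
      Q (tderiv (tderiv φ)) (∫ s in (0 : ℝ)..t, (t - s) • u s) = Q φ (u t - x))
    {t : ℝ} (ht : 0 ≤ t) {φ : TestFn} (hφ : φ ∈ testFnNonneg) :
    Q (translate t φ) x = Q φ (u t) - Q (tderiv φ) (∫ s in (0 : ℝ)..t, u s) := by
  refine (eq_of_hasDerivAt_primitive (f := fun a => Q (translate a φ) x)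
    (L := fun t => Q φ (∫ s in (0 : ℝ)..t, u s)
      - Q (tderiv φ) (∫ s in (0 : ℝ)..t, (t - s) • u s))
    (ℓ := fun t => Q φ (u t) - Q (tderiv φ) (∫ s in (0 : ℝ)..t, u s))
    (continuous_apply_translate hQ φ x)
    (fun t _ => (((Q φ).restrictScalars ℝ).hasFDerivAt.comp_hasDerivAt t
      (hasDerivAt_integral hu t)).sub
      (((Q (tderiv φ)).restrictScalars ℝ).hasFDerivAt.comp_hasDerivAt t
        (hasDerivAt_integral_sub_smul hu t))) (fun t ht => ?_) ht).symm
  refine ⟨fun s => Q (translate (t - s) φ) (∫ σ in (0 : ℝ)..s, u σ)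
    - Q (translate (t - s) (tderiv φ)) (∫ σ in (0 : ℝ)..s, (s - σ) • u σ), by simp,
    by simp only [sub_self, translate_zero], fun s hs => ?_⟩
  refine ((hasDerivAt_clm_apply (hasDerivAt_translate_sub hQ φ t s)
    (hasDerivAt_integral hu s)).sub (hasDerivAt_clm_apply
      (hasDerivAt_translate_sub hQ (tderiv φ) t s)
      (hasDerivAt_integral_sub_smul hu s))).congr_deriv ?_
  have h1 := h s hs.1 _ (translate_mem_testFnNonneg hφ (sub_nonneg.2 hs.2))
  rw [tderiv_translate, tderiv_translate, map_sub] at h1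
  rw [h1]
  abel

theorem deltaApply_eq_of_mildSolution {C : X →L[ℂ] X} {𝒢 : OpDist X} (h𝒢 : IsCDS C 𝒢)
    {A : X →ₗ.[ℂ] X} (hA : IsGeneratorCDS 𝒢 A) {u : ℝ → X} (hu : Continuous u) {x : X}
    (h : ∀ t : ℝ, 0 ≤ t → ((∫ s in (0 : ℝ)..t, u s), u t - x) ∈ A.graph) {t : ℝ} (ht : 0 ≤ t) :
    deltaApply 𝒢 t x = u t := by
  refine deltaApply_eq h𝒢.nondegenerate fun φ hφ => ?_
  refine orbit_first_order (hasDerivAt_apply_translate 𝒢) hu (fun t ht φ hφ => ?_) ht hφ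
  have h1 := (hA _ _).1 (h t ht) φ hφ
  rwa [map_neg] at h1

theorem cosineDeltaApply_eq_of_mildSolution {N : Normalizer} {C : X →L[ℂ] X} {G : OpDist X}
    (hG : IsCDCF N C G) {A : X →ₗ.[ℂ] X} (hA : IsGeneratorCDCF N G A) {u : ℝ → X}
    (hu : Continuous u) {x : X}
    (h : ∀ t : ℝ, 0 ≤ t → ((∫ s in (0 : ℝ)..t, (t - s) • u s), u t - x) ∈ A.graph) {t : ℝ}
    (ht : 0 ≤ t) : cosineDeltaApply N C G t x = u t := by
  have hnd : ∀ z, (∀ φ ∈ testFnNonneg, cosineMatrix N C G φ z = 0) → z = 0 := fun z hz =>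
    Prod.ext_iff.2 (hG.nondegenerate z.1 z.2 fun φ hφ => congrArg Prod.fst (hz φ hφ))
  have horb : ∀ φ ∈ testFnNonneg, primitive N G (translate t φ) x
      = primitive N G φ (u t) - primitive N G (tderiv φ) (∫ s in (0 : ℝ)..t, u s) := fun φ hφ =>
    orbit_second_order (hasDerivAt_primitive_translate N G) hu
      (fun t ht φ hφ => (hA _ _).1 (h t ht) φ hφ) ht hφ
  have hmem : ((0, x), (∫ s in (0 : ℝ)..t, u s, u t)) ∈ deltaGraph (cosineMatrix N C G) t := by
    intro φ hφ
    refine Prod.ext ?_ ?_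
    · change G (translate t φ) 0 + primitive N G (translate t φ) x
        = G φ (∫ s in (0 : ℝ)..t, u s) + primitive N G φ (u t)
      rw [map_zero, zero_add, horb φ hφ, primitive_tderiv, neg_apply]
      abel
    · change (-G (tderiv (translate t φ)) - (translate t φ) 0 • C) 0 + G (translate t φ) x
        = (-G (tderiv φ) - φ 0 • C) (∫ s in (0 : ℝ)..t, u s) + G φ (u t)
      -- the first component, for the derivative of the test function
      have h1 := horb (tderiv φ) (tderiv_mem_testFnNonneg hφ)
      rw [← tderiv_translate, primitive_tderiv, primitive_tderiv, primitive_tderiv,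
        neg_apply, neg_apply,
        neg_apply, neg_eq_iff_eq_neg] at h1
      rw [map_zero, zero_add, h1, apply_zero_of_mem_testFnNonneg hφ, zero_smul, sub_zero,
        neg_apply]
      abel
  rw [cosineDeltaApply, deltaApply_eq hnd hmem]

/-- If each vector of `V` is the initial value of a continuous almost periodic function whose Bohr
means are zero or belong to `S`, and `V` is dense, then `S` is total. -/
theorem dense_span_of_bohrMean_mem {V : Submodule ℂ X} {S : Set X}
    (h : ∀ x ∈ V, ∃ u : ℝ → X, AlmostPeriodic u ∧ Continuous u ∧ u 0 = x ∧
      ∀ r, ∃ p, HasBohrMean u r p ∧ (p ≠ 0 → p ∈ S)) (hV : Dense (V : Set X)) :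
    Dense (Submodule.span ℂ S : Set X) := by
  have hle : (V : Set X) ⊆ (Submodule.span ℂ S).topologicalClosure := by
    intro x hx
    obtain ⟨u, hu, hc, rfl, hr⟩ := h x hx
    refine mem_of_bohrMean_mem (Submodule.isClosed_topologicalClosure _) hu hc fun r => ?_
    obtain ⟨p, hp, hpS⟩ := hr r
    refine ⟨p, ?_, hp⟩
    rcases eq_or_ne p 0 with rfl | hne
    · exact zero_mem _
    · exact Submodule.le_topologicalClosure _ (Submodule.subset_span (hpS hne))
  have := hV.mono hle
  rwa [Submodule.topologicalClosure_coe, dense_closure] at this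

end Orbits

end CDist

open CDist in
theorem theorem2p5 {E : Type*} [NormedAddCommGroup E] [NormedSpace ℂ E] [CompleteSpace E]
    (C : E →L[ℂ] E) (hC : Function.Injective C) (A : E →ₗ.[ℂ] E) (V : Submodule ℂ E) :
    (∀ 𝒢 : CDist.OpDist E, CDist.IsCDS C 𝒢 → CDist.IsGeneratorCDS 𝒢 A →
      CDist.IsAlmostPeriodicCDS 𝒢 A V →
        (∀ r : ℝ, ∀ x ∈ V, ∃ p : E,
          CDist.HasBohrMean (fun s => CDist.deltaApply 𝒢 s x) r p ∧
          (p, (Complex.I * r) • p) ∈ A.graph) ∧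
        (Dense (V : Set E) →
          Dense (Submodule.span ℂ
            (CDist.eigenvectors A {μ | ∃ r : ℝ, μ = Complex.I * r}) : Set E))) ∧
    (∀ (N : CDist.Normalizer) (G : CDist.OpDist E), CDist.IsCDCF N C G →
      CDist.IsGeneratorCDCF N G A → CDist.IsAlmostPeriodicCDCF N C G A V →
        (∀ r : ℝ, ∀ x ∈ V, ∃ p : E,
          CDist.HasBohrMean (fun s => CDist.cosineDeltaApply N C G s x) r p ∧
          (p, (-(r : ℂ) ^ 2) • p) ∈ A.graph) ∧
        (Dense (V : Set E) →
          Dense (Submodule.span ℂ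
            (CDist.eigenvectors A {μ | ∃ a : ℝ, a ≤ 0 ∧ μ = a}) : Set E))) := by
  refine ⟨fun 𝒢 h𝒢 hA hap => ?_, fun N G hG hA hap => ?_⟩
  · have key : ∀ x ∈ V, ∃ u : ℝ → E, AlmostPeriodic u ∧ Continuous u ∧ u 0 = x ∧
        (∀ t, 0 ≤ t → u t = deltaApply 𝒢 t x) ∧
        ∀ r : ℝ, ∃ p, HasBohrMean u r p ∧ (p, (Complex.I * r) • p) ∈ A.graph := by
      intro x hx
      obtain ⟨u, hu, hu0, hgraph⟩ := exists_continuous_of_mem_solutionSpace (hap.1 hx)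
      have hδ : ∀ t, 0 ≤ t → deltaApply 𝒢 t x = u t := fun t ht =>
        deltaApply_eq_of_mildSolution h𝒢 hA hu hgraph ht
      have huap : AlmostPeriodic u := (hap.2 x hx).congr hδ
      obtain ⟨M, -, hM⟩ := huap.exists_bound hu
      refine ⟨u, huap, hu, hu0, fun t ht => (hδ t ht).symm, fun r => ?_⟩
      obtain ⟨p, hp⟩ := huap.exists_hasBohrMean hu r
      exact ⟨p, hp, (hA _ _).2 fun φ hφ => bohrMean_eigen_first_order hu hM
        (fun t ht => (hA _ _).1 (hgraph t ht) φ hφ) hp⟩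
    refine ⟨fun r x hx => ?_, dense_span_of_bohrMean_mem fun x hx => ?_⟩
    · obtain ⟨u, -, -, -, hδ, hr⟩ := key x hx
      obtain ⟨p, hp, hpA⟩ := hr r
      exact ⟨p, hp.congr hδ, hpA⟩
    · obtain ⟨u, huap, hu, hu0, -, hr⟩ := key x hx
      refine ⟨u, huap, hu, hu0, fun r => ?_⟩
      obtain ⟨p, hp, hpA⟩ := hr r
      exact ⟨p, hp, fun hne => ⟨hne, _, ⟨r, rfl⟩, hpA⟩⟩
  · have key : ∀ x ∈ V, ∃ u : ℝ → E, AlmostPeriodic u ∧ Continuous u ∧ u 0 = x ∧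
        (∀ t, 0 ≤ t → u t = cosineDeltaApply N C G t x) ∧
        ∀ r : ℝ, ∃ p, HasBohrMean u r p ∧ (p, (-(r : ℂ) ^ 2) • p) ∈ A.graph := by
      intro x hx
      obtain ⟨u, hu, hu0, hgraph⟩ := exists_continuous_of_mem_solutionSpace₂ (hap.1 hx)
      have hδ : ∀ t, 0 ≤ t → cosineDeltaApply N C G t x = u t := fun t ht =>
        cosineDeltaApply_eq_of_mildSolution hG hA hu hgraph ht
      have huap : AlmostPeriodic u := (hap.2 x hx).congr hδ
      obtain ⟨M, -, hM⟩ := huap.exists_bound hu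
      refine ⟨u, huap, hu, hu0, fun t ht => (hδ t ht).symm, fun r => ?_⟩
      obtain ⟨p, hp⟩ := huap.exists_hasBohrMean hu r
      exact ⟨p, hp, (hA _ _).2 fun φ hφ => bohrMean_eigen_second_order hu hM
        (fun t ht => (hA _ _).1 (hgraph t ht) φ hφ) hp⟩
    refine ⟨fun r x hx => ?_, dense_span_of_bohrMean_mem fun x hx => ?_⟩
    · obtain ⟨u, -, -, -, hδ, hr⟩ := key x hx
      obtain ⟨p, hp, hpA⟩ := hr r
      exact ⟨p, hp.congr hδ, hpA⟩
    · obtain ⟨u, huap, hu, hu0, -, hr⟩ := key x hx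
      refine ⟨u, huap, hu, hu0, fun r => ?_⟩
      obtain ⟨p, hp, hpA⟩ := hr r
      exact ⟨p, hp, fun hne =>
        ⟨hne, _, ⟨-r ^ 2, neg_nonpos.2 (sq_nonneg r), by push_cast; rfl⟩, hpA⟩⟩
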